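/- Let $q$ be a prime power, let $n\ge 2$ and $0\le d\le q$ be integers, and let $\mathbb{F}_{q^2}$ be the field with $q^2$ elements. A Hermitian matrix over $\mathbb{F}_{q^2}$ is a nonzero square matrix $H=(h_{ij})$ with $h_{ij}=h_{ji}^{\,q}$ for all $i,j$; its Hermitian variety is the projective zero set of the form $\sum_{i,j}h_{ij}x_ix_j^{\,q}$. Let $P\mathcal{U}_{n-1}\subset\mathbb{P}^n$ be the Hermitian variety of a Hermitian $(n+1)\times(n+1)$ matrix of rank $n$, and let $\mathcal{U}_{n-1}\subset\mathbb{P}^{n-1}$ be the Hermitian variety of an invertible Hermitian $n\times n$ matrix. For a form $G$ over $\mathbb{F}_{q^2}$ write $V(G)$ for its projective zero set, and put $$M_{n-1}(d)=\max_G |\mathcal{U}_{n-1}\cap V(G)(\mathbb{F}_{q^2})|,$$ where $G$ runs over the nonzero forms of degree $d$ in $\mathbb{F}_{q^2}[x_0,\dots,x_{n-1}]$. Let $\mathsf{P}_1,\dots,\mathsf{P}_m$ be an ordered list, without repetition, of all $\mathbb{F}_{q^2}$-rational points of $P\mathcal{U}_{n-1}$, each represented by the coordinate vector whose last nonzero coordinate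 is $1$, and let $C_d(P\mathcal{U}_{n-1})\subseteq\mathbb{F}_{q^2}^m$ be the linear code of all vectors $(G(\mathsf{P}_1),\dots,G(\mathsf{P}_m))$, where $G$ runs over the forms of degree $d$ in $\mathbb{F}_{q^2}[x_0,\dots,x_n]$ together with $0$. Then $C_d(P\mathcal{U}_{n-1})$ has length $$m=|P\mathcal{U}_{n-1}(\mathbb{F}_{q^2})|=1+q^2\,\frac{\left(q^{n-1}-(-1)^{n-1}\right)\left(q^n-(-1)^n\right)}{q^2-1},$$ dimension $\binom{n+d}{d}$ over $\mathbb{F}_{q^2}$, and its minimum distance $\mathsf{d}$ (the least Hamming weight of a nonzero codeword) satisfies $$\mathsf{d}\ \ge\ |P\mathcal{U}_{n-1}(\mathbb{F}_{q^2})|-\max\left\{|\mathcal{U}_{n-1}(\mathbb{F}_{q^2})|+(d-1)(q+1)q^{2n-4},\ 1+q^2M_{n-1}(d)\right\}.$$ -/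

import Mathlib

open scoped LinearAlgebra.Projectivization

namespace HermitianCode

noncomputable section

/-- `H` is a Hermitian matrix with respect to `x ↦ x ^ q`: it is nonzero and `h_ij = h_ji ^ q`. -/
def IsHermitianMatrix {F ι : Type*} [Field F] (q : ℕ) (H : Matrix ι ι F) : Prop :=
  H ≠ 0 ∧ ∀ i j, H i j = H j i ^ q

/-- The form `xᵀ H x^(q) = ∑ h_ij x_i x_j ^ q`. -/
def hermitianForm {F : Type*} [Field F] (q : ℕ) {N : ℕ} (H : Matrix (Fin N) (Fin N) F) :
    MvPolynomial (Fin N) F :=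
  ∑ i, ∑ j, MvPolynomial.C (H i j) * MvPolynomial.X i * MvPolynomial.X j ^ q

theorem exists_last_ne_zero {F : Type*} [Field F] [DecidableEq F] {N : ℕ}
    (P : ℙ F (Fin N → F)) : (Finset.univ.filter fun i => P.rep i ≠ 0).Nonempty := by
  obtain ⟨i, hi⟩ := Function.ne_iff.mp P.rep_nonzero
  exact ⟨i, by simpa using hi⟩

open Classical in
/-- The index of the last nonzero homogeneous coordinate of a projective point. -/
def lastIndex {F : Type*} [Field F] {N : ℕ} (P : ℙ F (Fin N → F)) : Fin N :=
  (Finset.univ.filter fun i => P.rep i ≠ 0).max' (exists_last_ne_zero P)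

/-- The coordinate vector of a projective point whose last nonzero coordinate is `1`. -/
def normRep {F : Type*} [Field F] {N : ℕ} (P : ℙ F (Fin N → F)) : Fin N → F :=
  (P.rep (lastIndex P))⁻¹ • P.rep

theorem rep_lastIndex_ne_zero {F : Type*} [Field F] {N : ℕ} (P : ℙ F (Fin N → F)) :
    P.rep (lastIndex P) ≠ 0 := by
  classical
  have h := Finset.max'_mem _ (exists_last_ne_zero P)
  have h2 := (Finset.mem_filter.mp h).2
  unfold lastIndex
  convert h2

theorem normRep_lastIndex {F : Type*} [Field F] {N : ℕ} (P : ℙ F (Fin N → F)) :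
    normRep P (lastIndex P) = 1 := by
  simp [normRep, rep_lastIndex_ne_zero P]

theorem normRep_of_lt {F : Type*} [Field F] {N : ℕ} (P : ℙ F (Fin N → F)) (j : Fin N)
    (hj : lastIndex P < j) : normRep P j = 0 := by
  classical
  by_contra h
  have hr : P.rep j ≠ 0 := fun h0 => h (by simp [normRep, h0])
  refine absurd hj (not_lt.mpr ?_)
  exact Finset.le_max' _ j (by simpa using hr)

theorem normRep_ne_zero {F : Type*} [Field F] {N : ℕ} (P : ℙ F (Fin N → F)) :
    normRep P ≠ 0 := by
  intro h
  have := normRep_lastIndex P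
  simp [h] at this

theorem mk_normRep {F : Type*} [Field F] {N : ℕ} (P : ℙ F (Fin N → F)) :
    Projectivization.mk F (normRep P) (normRep_ne_zero P) = P := by
  conv_rhs => rw [← P.mk_rep]
  rw [Projectivization.mk_eq_mk_iff']
  exact ⟨_, rfl⟩

/-- The set `V(G)(F)` of `F`-rational points of the projective zero set of a form `G`. -/
def zeros {F : Type*} [Field F] {N : ℕ} (G : MvPolynomial (Fin N) F) : Set (ℙ F (Fin N → F)) :=
  {P | MvPolynomial.eval (normRep P) G = 0}

/-- The set of `F`-rational points of the Hermitian variety of the matrix `H`. -/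
def hermitianVariety {F : Type*} [Field F] (q : ℕ) {N : ℕ} (H : Matrix (Fin N) (Fin N) F) :
    Set (ℙ F (Fin N → F)) :=
  zeros (hermitianForm q H)

/-- The maximal number of rational points that a hypersurface `V(G)` of degree `d` over `F`
has in common with `X`. -/
def maxSection {F : Type*} [Field F] {N : ℕ} (X : Set (ℙ F (Fin N → F))) (d : ℕ) : ℕ :=
  sSup {k | ∃ G : MvPolynomial (Fin N) F,
    G ≠ 0 ∧ G.IsHomogeneous d ∧ k = Nat.card ↥(X ∩ zeros G)}

/-- The evaluation map `G ↦ (G(P_1), …, G(P_m))` on forms of degree `d`, where the points are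
represented with last nonzero coordinate `1`. -/
def evalMap {F : Type*} [Field F] {N m : ℕ} (d : ℕ) (P : Fin m → ℙ F (Fin N → F)) :
    MvPolynomial.homogeneousSubmodule (Fin N) F d →ₗ[F] (Fin m → F) where
  toFun G i := MvPolynomial.eval (normRep (P i)) (G : MvPolynomial (Fin N) F)
  map_add' G G' := by ext i; simp
  map_smul' c G := by ext i; simp [MvPolynomial.smul_eval]

/-- The functional code `C_d(X)`, for an enumeration `e` of the rational points of `X`. -/
def functionalCode {F : Type*} [Field F] {N m : ℕ} (d : ℕ) (X : Set (ℙ F (Fin N → F)))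
    (e : Fin m ≃ X) : Submodule F (Fin m → F) :=
  LinearMap.range (evalMap d fun i => (e i : ℙ F (Fin N → F)))

open Classical in
/-- The minimum distance: the least Hamming weight of a nonzero codeword. -/
def minDist {F : Type*} [Field F] {m : ℕ} (C : Submodule F (Fin m → F)) : ℕ :=
  sInf {w | ∃ c ∈ C, c ≠ 0 ∧ w = hammingNorm c}

end

end HermitianCode

namespace HermitianCode

/-! ### Norm and trace for the quadratic extension with `q ^ 2` elements. -/

section FiniteField

variable {F : Type*} [Field F] [Fintype F] {q : ℕ}

/-! After a linear change of coordinates the cone is `∑_{i ≥ 1} x_i ^ (q + 1) = 0`, with vertex `(1,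
0, …, 0)` (`exists_linearEquiv_diagonal`). Expand a form `G` of degree `d` in powers of `x_0`, with
degree `j` and leading coefficient `g`, a form of degree `e = d - j` on the base. Over a base point,
at most `j` values of `x_0` give a zero of `G` if `g ≠ 0` there, and at most `q ^ 2` otherwise. If
the base has `u` points, of which `X` lie on `g = 0`, then `G` has at most `[e ≠ 0] + q ^ 2 X + j (u
- X)` zeros on the cone (`card_cone_section_le`).

If `j = 0`, then `X ≤ M_{n-1}(d)` gives the second term of the maximum. If `j > 0` and `n ≥ 3`, the
first term follows from `u ≤ (q + 1) q ^ (2n - 4)` and `X (q ^ 2 - 1) ≤ e (q + 1) (q ^ (2n - 4) -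
1)`; for `n = 2` the base consists of `q + 1` points on a line and `X ≤ e` (`cone_bound_arith`).

The bound on `X` (`card_section_le`) uses an isotropic `P` with `g(P) ≠ 0` and an anisotropic `v`
orthogonal to `P`. On a coset of `⟨P, v⟩`, with coordinates `(y, s)`, the two equations have leading
monomials `y ^ e` and `s ^ (q + 1)`, so the footprint bound leaves at most `e (q + 1)` solutions.
The trivial coset contributes none.

Such a `P` exists because a nonzero form of degree at most `q` cannot vanish on all isotropic
vectors (`exists_isotropic_eval_ne_zero`). The same fact makes evaluation injective, which gives the
dimension. The length comes from a recursive count of isotropic vectors. -/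

theorem two_le_of_card_eq_sq (hF : Fintype.card F = q ^ 2) : 2 ≤ q := by
  have h := Fintype.one_lt_card (α := F)
  rw [hF] at h
  by_contra! hq
  interval_cases q <;> simp at h

/-- In a field with `q ^ 2` elements, `x ↦ x ^ q` is a ring homomorphism. -/
theorem exists_ringHom_eq_pow (hF : Fintype.card F = q ^ 2) :
    ∃ σ : F →+* F, ∀ x, σ x = x ^ q := by
  obtain ⟨p, hp⟩ := CharP.exists F
  obtain ⟨k, hpp, hk⟩ := FiniteField.card F p
  have hdvd : q ∣ p ^ (k : ℕ) := by rw [← hk, hF]; exact dvd_pow_self _ two_ne_zero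
  obtain ⟨l, -, rfl⟩ := (Nat.dvd_prime_pow hpp).1 hdvd
  have : ExpChar F p := ExpChar.prime hpp
  exact ⟨iterateFrobenius F p l, fun x => iterateFrobenius_def p l x⟩

theorem pow_q_pow_q (hF : Fintype.card F = q ^ 2) (x : F) : (x ^ q) ^ q = x := by
  rw [← pow_mul, ← sq, ← hF, FiniteField.pow_card]

open Classical in
/-- The norm map `x ↦ x ^ (q + 1)` onto the fixed field of `x ↦ x ^ q` has fibres of size
`q + 1` away from `0`. -/
theorem card_norm_fiber (hF : Fintype.card F = q ^ 2) {c : F} (hc : c ≠ 0) (hcq : c ^ q = c) :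
    (Finset.univ.filter fun x : F => x ^ (q + 1) = c).card = q + 1 := by
  have hq := two_le_of_card_eq_sq hF
  have hcard : Nat.card Fˣ = (q + 1) * (q - 1) := by
    rw [Nat.card_units, Nat.card_eq_fintype_card, hF]
    exact Nat.sq_sub_sq q 1
  obtain ⟨g, hg⟩ := IsCyclic.exists_generator (α := Fˣ)
  have hog : orderOf g = (q + 1) * (q - 1) := by rw [orderOf_eq_card_of_forall_mem_zpowers hg, hcard]
  obtain ⟨k, hk⟩ := (mem_powers_iff_mem_zpowers.2 (hg (Units.mk0 c hc)))
  have hk' : g ^ k = Units.mk0 c hc := hk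
  -- Being fixed by the `q`-th power forces `q + 1 ∣ k`, so `c = (g ^ l) ^ (q + 1)`, and the fibre
  -- is the translate by `g ^ l` of the kernel of the `(q + 1)`-th power map. The value `1` at `x =
  -- 0` in the bijection below is never used, since `c ≠ 0`.
  have h1 : (Units.mk0 c hc) ^ (q - 1) = 1 := by
    ext
    have : c ^ (q - 1) * c = 1 * c := by
      rw [← pow_succ, Nat.sub_add_cancel (by omega), hcq, one_mul]
    simpa using mul_right_cancel₀ hc this
  rw [← hk', ← pow_mul] at h1
  have h2 := orderOf_dvd_of_pow_eq_one h1
  rw [hog] at h2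
  obtain ⟨l, rfl⟩ := Nat.dvd_of_mul_dvd_mul_right (by omega : 0 < q - 1) h2
  have hker := IsCyclic.card_powMonoidHom_ker (G := Fˣ) (q + 1)
  rw [hcard, Nat.gcd_mul_right_left] at hker
  refine Eq.trans ?_ hker
  rw [Nat.card_eq_fintype_card, Fintype.card_subtype]
  refine Finset.card_bij' (fun x _ => if hx : x = 0 then 1 else (Units.mk0 x hx) * (g ^ l)⁻¹)
    (fun u _ => ((u * g ^ l : Fˣ) : F)) ?_ ?_ ?_ ?_
  · intro x hx
    simp only [Finset.mem_filter, Finset.mem_univ, true_and] at hx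
    have hx0 : x ≠ 0 := by rintro rfl; simp at hx; exact hc hx.symm
    simp only [hx0, dite_false, Finset.mem_filter, Finset.mem_univ, true_and, MonoidHom.mem_ker,
      powMonoidHom_apply, mul_pow, inv_pow]
    rw [mul_inv_eq_one, ← pow_mul, mul_comm l, hk']
    ext; simpa using hx
  · intro u hu
    simp only [Finset.mem_filter, Finset.mem_univ, true_and, MonoidHom.mem_ker,
      powMonoidHom_apply] at hu ⊢
    rw [← Units.val_pow_eq_pow_val, mul_pow, hu, one_mul, ← pow_mul, mul_comm l, hk']
    rfl
  · intro x hx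
    simp only [Finset.mem_filter, Finset.mem_univ, true_and] at hx
    have hx0 : x ≠ 0 := by rintro rfl; simp at hx; exact hc hx.symm
    simp [hx0]
  · intro u hu
    simp only [Units.ne_zero, dite_false, Units.mk0_val, mul_inv_cancel_right]

theorem exists_norm_eq (hF : Fintype.card F = q ^ 2) {c : F} (hc : c ≠ 0) (hcq : c ^ q = c) :
    ∃ x : F, x ^ (q + 1) = c := by
  classical
  have h := card_norm_fiber hF hc hcq
  obtain ⟨x, hx⟩ := Finset.card_pos.1 (h.symm ▸ Nat.succ_pos q :
    0 < (Finset.univ.filter fun x : F => x ^ (q + 1) = c).card)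
  exact ⟨x, (Finset.mem_filter.1 hx).2⟩

/-- The polynomial `X + X ^ q` has degree `q`, too few roots to vanish on all `q ^ 2` elements. This
replaces division by `2` in the polarization argument, so characteristic `2` needs no separate
treatment. -/
theorem exists_trace_ne_zero (hF : Fintype.card F = q ^ 2) : ∃ t : F, t + t ^ q ≠ 0 := by
  by_contra! h
  have hq := two_le_of_card_eq_sq hF
  have hdeg : (Polynomial.X + Polynomial.X ^ q : Polynomial F).natDegree = q := by
    rw [Polynomial.natDegree_add_eq_right_of_natDegree_lt] <;> simp
    omega
  have h0 : (Polynomial.X + Polynomial.X ^ q : Polynomial F) = 0 := by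
    refine Polynomial.eq_zero_of_natDegree_lt_card_of_eval_eq_zero _ (f := id)
      Function.injective_id (fun i => by simpa using h i) ?_
    rw [hdeg, hF]
    nlinarith
  rw [h0] at hdeg
  simp at hdeg
  omega

end FiniteField

/-! ### Orthonormal bases for Hermitian forms over a finite field. -/

section Diagonalization

variable {F : Type*} [Field F] {q : ℕ} {σ : F →+* F}
  {V : Type*} [AddCommGroup V] [Module F V]

/-- A sesquilinear form is Hermitian if swapping the arguments conjugates the value. -/
def IsHermitianForm (B : V →ₗ[F] V →ₛₗ[σ] F) : Prop :=
  ∀ x y, B x y = σ (B y x)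

theorem IsHermitianForm.self_pow (hσ : ∀ x, σ x = x ^ q) {B : V →ₗ[F] V →ₛₗ[σ] F}
    (hB : IsHermitianForm B) (x : V) : B x x ^ q = B x x := by
  rw [← hσ, ← hB]

/-- A Hermitian form vanishes identically on a subspace all of whose vectors are isotropic. -/
theorem IsHermitianForm.eq_zero_of_self_eq_zero [Fintype F] (hF : Fintype.card F = q ^ 2)
    (hσ : ∀ x, σ x = x ^ q) {B : V →ₗ[F] V →ₛₗ[σ] F} (hB : IsHermitianForm B)
    (W : Submodule F V) (h : ∀ x ∈ W, B x x = 0) {x y : V} (hx : x ∈ W) (hy : y ∈ W) :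
    B x y = 0 := by
  by_contra hb
  obtain ⟨t, ht⟩ := exists_trace_ne_zero hF
  apply ht
  -- With this scaling the value of the form at `a • x + y` is `t + t ^ q`, which isotropy would
  -- force to be zero.
  set a := t * (B x y)⁻¹ with ha
  have h1 := h (a • x + y) (W.add_mem (W.smul_mem _ hx) hy)
  have h2 : B y x = σ (B x y) := hB y x
  simp only [map_add, map_smul, LinearMap.add_apply, LinearMap.smul_apply, h x hx, h y hy,
    LinearMap.map_smulₛₗ, smul_eq_mul, h2] at h1
  rw [← hσ]
  have h3 : a * B x y = t := by rw [ha]; field_simp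
  rw [← h3, map_mul]
  linear_combination h1

/-- Over a field with `q ^ 2` elements, a Hermitian form has a basis in which it is
`diag(1, …, 1, 0, …, 0)`. -/
theorem IsHermitianForm.exists_basis [Fintype F] (hF : Fintype.card F = q ^ 2) (hσ : ∀ x, σ x = x ^ q)
    (n : ℕ) : ∀ {V : Type _} [AddCommGroup V] [Module F V] [FiniteDimensional F V]
    {B : V →ₗ[F] V →ₛₗ[σ] F}, IsHermitianForm B → Module.finrank F V = n →
    ∃ (r : ℕ) (b : Module.Basis (Fin n) F V),
      ∀ i j, B (b i) (b j) = if i = j ∧ (i : ℕ) < r then 1 else 0 := by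
  induction n with
  | zero =>
    intro V _ _ _ B hB hn
    exact ⟨0, Module.finBasisOfFinrankEq F V hn, fun i => i.elim0⟩
  | succ n ih =>
    intro V _ _ _ B hB hn
    by_cases h0 : ∀ x, B x x = 0
    · refine ⟨0, Module.finBasisOfFinrankEq F V hn, fun i j => ?_⟩
      simpa using hB.eq_zero_of_self_eq_zero hF hσ ⊤ (fun x _ => h0 x) trivial trivial
    push Not at h0
    obtain ⟨y, hy⟩ := h0
    obtain ⟨a, ha⟩ := exists_norm_eq hF (inv_ne_zero hy)
      (by rw [inv_pow, hB.self_pow hσ])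
    set x := a • y with hxdef
    have hx : B x x = 1 := by
      rw [hxdef]
      simp only [map_smul, LinearMap.smul_apply, LinearMap.map_smulₛₗ, smul_eq_mul, hσ]
      rw [← mul_assoc, ← pow_succ, ha, inv_mul_cancel₀ hy]
    -- The orthogonal complement of the unit vector `x` is a hyperplane not containing `x`; the
    -- induction continues on it.
    set W : Submodule F V := LinearMap.ker (B.flip x) with hW
    have hmem : ∀ z, z ∈ W ↔ B z x = 0 := fun z => by simp [hW]
    have hxW : x ∉ W := by rw [hmem, hx]; exact one_ne_zero
    have hfin : Module.finrank F W = n := by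
      have h1 := LinearMap.finrank_range_add_finrank_ker (B.flip x)
      have h2 : LinearMap.range (B.flip x) = ⊤ :=
        LinearMap.range_eq_top.2 (LinearMap.surjective (f := B.flip x)
          (fun h => by have := LinearMap.congr_fun h x; simp [hx] at this))
      rw [h2, finrank_top, Module.finrank_self, hn] at h1
      rw [hW]
      omega
    let B' : W →ₗ[F] W →ₛₗ[σ] F := B.domRestrict₁₂ W W
    have hB' : IsHermitianForm B' := fun u v => hB u v
    obtain ⟨r, b, hb⟩ := ih hB' hfin
    refine ⟨r + 1, Module.Basis.mkFinCons x b ?_ ?_, ?_⟩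
    · intro c z hz hcz
      have := congrArg (fun v => B v x) hcz
      simpa [hx, (hmem z).1 hz] using this
    · intro z
      refine ⟨-B z x, ?_⟩
      rw [hmem]
      simp [hx]
    · intro i j
      rw [Module.Basis.coe_mkFinCons]
      refine Fin.cases ?_ (fun i => ?_) i <;> refine Fin.cases ?_ (fun j => ?_) j
      · simp [hx]
      · have : B x (b j) = 0 := by
          rw [hB, (hmem _).1 (b j).2, map_zero]
        simpa [(Fin.succ_ne_zero j).symm] using this
      · have : B (b i) x = 0 := (hmem _).1 (b i).2
        simpa [(Fin.succ_ne_zero i)] using this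
      · have := hb i j
        simpa [B', LinearMap.domRestrict₁₂_apply] using this

end Diagonalization

/-! ### The footprint bound for plane point sets. -/

section Footprint

variable {F A : Type*} [Field F] [CommRing A] [Algebra F A]

/-- The span of the monomials `Y ^ a * S ^ b` with exponents `(a, b)` in `T`. -/
def monomialSpan (F : Type*) {A : Type*} [Field F] [CommRing A] [Algebra F A] (Y S : A)
    (T : Set (ℕ × ℕ)) : Submodule F A :=
  Submodule.span F ((fun p : ℕ × ℕ => Y ^ p.1 * S ^ p.2) '' T)

theorem mem_monomialSpan {Y S : A} {T : Set (ℕ × ℕ)} {a b : ℕ} (h : (a, b) ∈ T) :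
    Y ^ a * S ^ b ∈ monomialSpan F Y S T :=
  Submodule.subset_span ⟨(a, b), h, rfl⟩

theorem monomial_mul_mem {Y S x : A} {T : Set (ℕ × ℕ)} {M : Submodule F A} {a b : ℕ}
    (hx : x ∈ monomialSpan F Y S T)
    (h : ∀ p ∈ T, Y ^ (a + p.1) * S ^ (b + p.2) ∈ M) : Y ^ a * S ^ b * x ∈ M := by
  induction hx using Submodule.span_induction with
  | mem x hx =>
    obtain ⟨p, hp, rfl⟩ := hx
    convert h p hp using 1
    simp only [pow_add]
    ring
  | zero => simp
  | add x y _ _ hx hy => rw [mul_add]; exact M.add_mem hx hy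
  | smul c x _ hx => rw [mul_smul_comm]; exact M.smul_mem c hx

theorem monomialSpan_mul_mem {Y S x y : A} {T T' T'' : Set (ℕ × ℕ)}
    (hx : x ∈ monomialSpan F Y S T) (hy : y ∈ monomialSpan F Y S T')
    (h : ∀ p ∈ T, ∀ p' ∈ T', p + p' ∈ T'') : x * y ∈ monomialSpan F Y S T'' := by
  induction hx using Submodule.span_induction with
  | mem x hx =>
    obtain ⟨p, hp, rfl⟩ := hx
    exact monomial_mul_mem hy fun p' hp' => mem_monomialSpan (h p hp p' hp')
  | zero => simp
  | add x y _ _ hx hy => rw [add_mul]; exact Submodule.add_mem _ hx hy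
  | smul c x _ hx => rw [smul_mul_assoc]; exact Submodule.smul_mem _ c hx

/-- Division with remainder by relations with leading monomials `Y ^ e` and `S ^ m`. -/
theorem monomial_mem_of_relations {Y S : A} {e m : ℕ}
    (hY : Y ^ e ∈ monomialSpan F Y S {p | p.1 + p.2 ≤ e ∧ p.1 < e})
    (hS : S ^ m ∈ monomialSpan F Y S {p | p.1 + p.2 < m}) (k : ℕ) :
    ∀ a b, a + b ≤ k → Y ^ a * S ^ b ∈ monomialSpan F Y S {p | p.1 < e ∧ p.2 < m} := by
  -- The order is total degree first, then the exponent of `Y`. Rewriting `Y ^ e` does not raise the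
  -- total degree and lowers the `Y`-exponent; rewriting `S ^ m` lowers the total degree.
  induction k using Nat.strong_induction_on with
  | _ k ihk =>
  intro a
  induction a using Nat.strong_induction_on with
  | _ a iha =>
  intro b hab
  by_cases hae : e ≤ a
  · have : Y ^ a * S ^ b = Y ^ (a - e) * S ^ b * Y ^ e := by
      rw [mul_right_comm, ← pow_add, Nat.sub_add_cancel hae]
    rw [this]
    refine monomial_mul_mem hY ?_
    rintro ⟨a', b'⟩ ⟨h1, h2⟩
    exact iha _ (by dsimp at *; omega) _ (by dsimp at *; omega)
  by_cases hbm : m ≤ b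
  · have : Y ^ a * S ^ b = Y ^ a * S ^ (b - m) * S ^ m := by
      rw [mul_assoc, ← pow_add, Nat.sub_add_cancel hbm]
    rw [this]
    refine monomial_mul_mem hS ?_
    rintro ⟨a', b'⟩ h1
    rw [Set.mem_ofPred_eq] at h1
    exact ihk (k - 1) (by dsimp at *; omega) _ _ (by dsimp at *; omega)
  · exact mem_monomialSpan ⟨by omega, by omega⟩

/-- The footprint bound for finite sets of points in the plane. -/
theorem card_le_of_relations [Fintype F] (Z : Finset (F × F)) {e m : ℕ}
    (hY : (fun z : Z => z.1.1) ^ e ∈ monomialSpan F (fun z : Z => z.1.1) (fun z : Z => z.1.2)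
      {p | p.1 + p.2 ≤ e ∧ p.1 < e})
    (hS : (fun z : Z => z.1.2) ^ m ∈ monomialSpan F (fun z : Z => z.1.1) (fun z : Z => z.1.2)
      {p | p.1 + p.2 < m}) : Z.card ≤ e * m := by
  classical
  set Y : Z → F := fun z => z.1.1
  set S : Z → F := fun z => z.1.2
  set M := monomialSpan F Y S {p | p.1 < e ∧ p.2 < m} with hM
  have hmon : ∀ a b, Y ^ a * S ^ b ∈ M := fun a b => monomial_mem_of_relations hY hS _ a b le_rfl
  have hpoly : ∀ p r : Polynomial F, Polynomial.aeval Y p * Polynomial.aeval S r ∈ M := by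
    intro p r
    rw [Polynomial.aeval_eq_sum_range, Polynomial.aeval_eq_sum_range, Finset.sum_mul_sum]
    refine Submodule.sum_mem _ fun i _ => Submodule.sum_mem _ fun j _ => ?_
    rw [smul_mul_smul_comm]
    exact M.smul_mem _ (hmon i j)
  -- The indicator function of a point is a polynomial in its two coordinates, so the monomials span
  -- all functions on `Z`. Hence `Z.card` is the dimension of a space spanned by `e * m` monomials.
  have htop : M = ⊤ := by
    rw [eq_top_iff]
    intro f _
    have hf : f = ∑ z : Z, f z • Pi.single z (1 : F) := by
      ext z
      simp [Finset.sum_apply, Pi.single_apply]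
    rw [hf]
    refine Submodule.sum_mem _ fun z _ => M.smul_mem _ ?_
    let ind : F → Polynomial F := fun c => 1 - (Polynomial.X - Polynomial.C c) ^ (Fintype.card F - 1)
    have hind : ∀ c x : F, (ind c).eval x = if x = c then 1 else 0 := by
      intro c x
      have h1 : Fintype.card F - 1 ≠ 0 := by
        have := Fintype.one_lt_card (α := F)
        omega
      split_ifs with h
      · simp [ind, h, h1]
      · simp [ind, FiniteField.pow_card_sub_one_eq_one _ (sub_ne_zero.2 h)]
    convert hpoly (ind z.1.1) (ind z.1.2) using 1
    ext x
    have hev : ∀ (T : Z → F) (p : Polynomial F), Polynomial.aeval T p x = p.eval (T x) := by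
      intro T p
      rw [← Polynomial.coe_aeval_eq_eval]
      exact (Polynomial.aeval_algHom_apply (Pi.evalAlgHom F (fun _ : Z => F) x) T p).symm
    rw [Pi.mul_apply, hev, hev, hind, hind, Pi.single_apply]
    simp only [Y, S, Subtype.ext_iff, Prod.ext_iff]
    by_cases h1 : x.1.1 = z.1.1 <;> by_cases h2 : x.1.2 = z.1.2 <;> simp [h1, h2]
  have hle : Module.finrank F M ≤ e * m := by
    have hrange : (fun p : ℕ × ℕ => Y ^ p.1 * S ^ p.2) '' {p | p.1 < e ∧ p.2 < m} =
        Set.range fun p : Fin e × Fin m => Y ^ (p.1 : ℕ) * S ^ (p.2 : ℕ) := by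
      ext x
      constructor
      · rintro ⟨⟨a, b⟩, ⟨ha, hb⟩, rfl⟩
        exact ⟨(⟨a, ha⟩, ⟨b, hb⟩), rfl⟩
      · rintro ⟨⟨a, b⟩, rfl⟩
        exact ⟨(a, b), ⟨a.2, b.2⟩, rfl⟩
    rw [hM, monomialSpan, hrange]
    refine (finrank_range_le_card _).trans ?_
    simp
  rw [htop, finrank_top, Module.finrank_fintype_fun_eq_card, Fintype.card_coe] at hle
  exact hle

/-- `x` is `c * Y ^ k` up to monomials of total degree at most `k` and smaller `Y`-degree. -/
def HasLeadingCoeff (Y S : A) (k : ℕ) (x : A) (c : F) : Prop :=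
  x - c • Y ^ k ∈ monomialSpan F Y S {p | p.1 + p.2 ≤ k ∧ p.1 < k}

/-- In `xy - cc'Y^(k+l) = (x - cY^k) y + cY^k (y - c'Y^l)`, each summand has one factor of strictly
smaller `Y`-degree, while total degrees add. -/
theorem HasLeadingCoeff.mul {Y S x y : A} {k l : ℕ} {c c' : F}
    (hx : HasLeadingCoeff Y S k x c) (hy : HasLeadingCoeff Y S l y c') :
    HasLeadingCoeff Y S (k + l) (x * y) (c * c') := by
  have h : x * y - (c * c') • Y ^ (k + l) =
      (x - c • Y ^ k) * y + (c • Y ^ k) * (y - c' • Y ^ l) := by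
    simp only [Algebra.smul_def, map_mul, pow_add]
    ring
  have hY : ∀ (k : ℕ) (c : F), c • Y ^ k ∈ monomialSpan F Y S {p | p.1 + p.2 ≤ k} := fun k c =>
    Submodule.smul_mem _ _ (by
      have h0 : (k, 0) ∈ {p : ℕ × ℕ | p.1 + p.2 ≤ k} := by simp
      simpa using mem_monomialSpan (F := F) (Y := Y) (S := S) h0)
  have hy' : y ∈ monomialSpan F Y S {p | p.1 + p.2 ≤ l} := by
    rw [← sub_add_cancel y (c' • Y ^ l)]
    exact Submodule.add_mem _ (Submodule.span_mono (Set.image_mono fun p hp => hp.1) hy) (hY _ _)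
  rw [HasLeadingCoeff, h]
  refine Submodule.add_mem _ (monomialSpan_mul_mem hx hy' ?_) (monomialSpan_mul_mem (hY k c) hy ?_)
  · rintro ⟨a, b⟩ ⟨h1, h2⟩ ⟨a', b'⟩ h3
    simp only [Set.mem_ofPred_eq, Prod.mk_add_mk] at *
    omega
  · rintro ⟨a, b⟩ h3 ⟨a', b'⟩ ⟨h1, h2⟩
    simp only [Set.mem_ofPred_eq, Prod.mk_add_mk] at *
    omega

theorem HasLeadingCoeff.one {Y S : A} : HasLeadingCoeff Y S 0 1 (1 : F) := by
  simp [HasLeadingCoeff]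

theorem HasLeadingCoeff.pow {Y S x : A} {k : ℕ} {c : F}
    (hx : HasLeadingCoeff Y S k x c) (n : ℕ) : HasLeadingCoeff Y S (n * k) (x ^ n) (c ^ n) := by
  induction n with
  | zero => simpa using HasLeadingCoeff.one
  | succ n ih => rw [pow_succ, pow_succ, add_mul, one_mul]; exact ih.mul hx

theorem HasLeadingCoeff.prod {ι : Type*} {Y S : A} (s : Finset ι) {x : ι → A} {k : ι → ℕ}
    {c : ι → F} (h : ∀ i ∈ s, HasLeadingCoeff Y S (k i) (x i) (c i)) :
    HasLeadingCoeff Y S (∑ i ∈ s, k i) (∏ i ∈ s, x i) (∏ i ∈ s, c i) := by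
  classical
  induction s using Finset.induction_on with
  | empty => simpa using HasLeadingCoeff.one
  | insert i s hi ih =>
    rw [Finset.sum_insert hi, Finset.prod_insert hi, Finset.prod_insert hi]
    exact (h i (by simp)).mul (ih fun j hj => h j (by simp [hj]))

/-- Restricting a form `g` of degree `e` to the affine plane `w + ⟨P, v⟩` gives a polynomial whose
leading coefficient in the direction of `P` is `g(P)`. -/
theorem hasLeadingCoeff_aeval {n e : ℕ} {g : MvPolynomial (Fin n) F} (hg : g.IsHomogeneous e)
    (P v w : Fin n → F) (Y S : A) :
    HasLeadingCoeff Y S e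
      (MvPolynomial.aeval (fun i => P i • Y + v i • S + algebraMap F A (w i)) g)
      (MvPolynomial.eval P g) := by
  rw [HasLeadingCoeff, MvPolynomial.aeval_def, MvPolynomial.eval₂_eq', MvPolynomial.eval_eq',
    Finset.sum_smul, ← Finset.sum_sub_distrib]
  refine Submodule.sum_mem _ fun d hd => ?_
  have hdeg : ∑ i, d i * 1 = e := by
    rw [← hg (MvPolynomial.mem_support_iff.1 hd)]
    simp [Finsupp.weight_apply, Finsupp.sum_fintype]
  have h1 : ∀ i, HasLeadingCoeff Y S 1 (P i • Y + v i • S + algebraMap F A (w i)) (P i) := by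
    intro i
    have : P i • Y + v i • S + algebraMap F A (w i) - P i • Y ^ 1 =
        v i • (Y ^ 0 * S ^ 1) + w i • (Y ^ 0 * S ^ 0) := by
      simp [Algebra.smul_def]
      ring
    rw [HasLeadingCoeff, this]
    exact Submodule.add_mem _ (Submodule.smul_mem _ _ (mem_monomialSpan (by simp)))
      (Submodule.smul_mem _ _ (mem_monomialSpan (by simp)))
  have h2 := HasLeadingCoeff.prod Finset.univ fun i _ => (h1 i).pow (d i)
  rw [hdeg] at h2
  have h3 := Submodule.smul_mem _ (MvPolynomial.coeff d g) h2
  rwa [smul_sub, smul_smul, Algebra.smul_def] at h3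

/-- A finite set of points `(y, s)` of the plane with `g(w + y P + s v) = 0` on which `s ^ m` is a
polynomial of degree less than `m` has at most `deg g * m` elements, provided `g(P) ≠ 0`. -/
theorem card_le_of_eval_eq_zero [Fintype F] {n e m : ℕ} {g : MvPolynomial (Fin n) F}
    (hg : g.IsHomogeneous e) {P v w : Fin n → F} (hP : MvPolynomial.eval P g ≠ 0)
    (Z : Finset (F × F)) (hZ : ∀ z ∈ Z, MvPolynomial.eval (w + z.1 • P + z.2 • v) g = 0)
    (hS : (fun z : Z => z.1.2) ^ m ∈ monomialSpan F (fun z : Z => z.1.1) (fun z : Z => z.1.2)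
      {p | p.1 + p.2 < m}) : Z.card ≤ e * m := by
  refine card_le_of_relations Z ?_ hS
  have h := hasLeadingCoeff_aeval hg P v w (fun z : Z => z.1.1) (fun z : Z => z.1.2)
  have h0 : MvPolynomial.aeval (fun i => P i • (fun z : Z => z.1.1) + v i • (fun z : Z => z.1.2) +
      algebraMap F (Z → F) (w i)) g = 0 := by
    ext z
    rw [Pi.zero_apply, ← hZ z z.2]
    refine (MvPolynomial.comp_aeval_apply _ (Pi.evalAlgHom F (fun _ : Z => F) z) g).trans ?_
    rw [MvPolynomial.aeval_eq_eval]
    congr 2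
    ext i
    simp
    ring
  -- Since `g` vanishes on `Z`, only `-g(P) • Y ^ e` remains on the left; dividing by `-g(P)` gives
  -- the relation for `Y ^ e`.
  rw [HasLeadingCoeff, h0, zero_sub] at h
  have h1 := Submodule.smul_mem _ (-(MvPolynomial.eval P g)⁻¹) h
  simpa [smul_smul, hP] using h1

end Footprint

/-! ### Homogeneous forms, their dimension and linear substitutions. -/

section Forms

variable {F : Type*} [Field F]

theorem eval_smul_of_isHomogeneous {N d : ℕ} {G : MvPolynomial (Fin N) F} (hG : G.IsHomogeneous d)
    (c : F) (x : Fin N → F) :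
    MvPolynomial.eval (c • x) G = c ^ d * MvPolynomial.eval x G := by
  rw [MvPolynomial.eval_eq', MvPolynomial.eval_eq', Finset.mul_sum]
  refine Finset.sum_congr rfl fun k hk => ?_
  have hdeg : ∑ i, k i = d := by
    rw [← hG (MvPolynomial.mem_support_iff.1 hk)]
    simp [Finsupp.weight_apply, Finsupp.sum_fintype]
  simp only [Pi.smul_apply, smul_eq_mul, mul_pow, Finset.prod_mul_distrib,
    Finset.prod_pow_eq_pow_sum, hdeg]
  ring

theorem finrank_homogeneousSubmodule (n d : ℕ) :
    Module.finrank F (MvPolynomial.homogeneousSubmodule (Fin (n + 1)) F d) = (n + d).choose d := by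
  classical
  let T : Finset (Fin (n + 1) →₀ ℕ) := Finset.univ.finsuppAntidiag d
  let v : T → MvPolynomial (Fin (n + 1)) F := fun k => MvPolynomial.monomial k.1 1
  have hmem : ∀ k : Fin (n + 1) →₀ ℕ, k ∈ T ↔ k.degree = d := by
    intro k
    simp [T, Finset.mem_finsuppAntidiag, Finsupp.degree_eq_sum]
  have hv : LinearIndependent F v := by
    have h := (MvPolynomial.basisMonomials (Fin (n + 1)) F).linearIndependent
    have := h.comp (fun k : T => k.1) Subtype.val_injective
    simpa [Function.comp_def, v] using this
  have hspan : Submodule.span F (Set.range v) =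
      MvPolynomial.homogeneousSubmodule (Fin (n + 1)) F d := by
    apply le_antisymm
    · rw [Submodule.span_le]
      rintro _ ⟨k, rfl⟩
      exact MvPolynomial.isHomogeneous_monomial _ ((hmem _).1 k.2)
    · intro G hG
      rw [MvPolynomial.mem_homogeneousSubmodule] at hG
      rw [← MvPolynomial.support_sum_monomial_coeff G]
      refine Submodule.sum_mem _ fun k hk => ?_
      have hk' : k ∈ T := by
        rw [hmem]
        by_contra hne
        exact MvPolynomial.mem_support_iff.1 hk (hG.coeff_eq_zero hne)
      have : MvPolynomial.monomial k (MvPolynomial.coeff k G) =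
          MvPolynomial.coeff k G • v ⟨k, hk'⟩ := by
        simp [v, MvPolynomial.smul_monomial]
      rw [this]
      exact Submodule.smul_mem _ _ (Submodule.subset_span ⟨_, rfl⟩)
  rw [← hspan, finrank_span_eq_card hv, Fintype.card_coe,
    Finset.card_finsuppAntidiag_nat_eq_choose]
  simp [Nat.add_right_comm]

/-- The composition of a polynomial with a linear map. -/
noncomputable def linearSubst {M N : ℕ} (φ : (Fin M → F) →ₗ[F] (Fin N → F))
    (G : MvPolynomial (Fin N) F) : MvPolynomial (Fin M) F :=
  MvPolynomial.aeval (fun i => ∑ j, MvPolynomial.C (φ (Pi.single j 1) i) * MvPolynomial.X j) G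

theorem eval_linearSubst {M N : ℕ} (φ : (Fin M → F) →ₗ[F] (Fin N → F))
    (G : MvPolynomial (Fin N) F) (x : Fin M → F) :
    MvPolynomial.eval x (linearSubst φ G) = MvPolynomial.eval (φ x) G := by
  have h := MvPolynomial.comp_aeval_apply
    (fun i => ∑ j, MvPolynomial.C (φ (Pi.single j 1) i) * MvPolynomial.X j)
    (MvPolynomial.aeval (R := F) x) G
  rw [MvPolynomial.aeval_eq_eval, MvPolynomial.aeval_eq_eval] at h
  rw [linearSubst]
  refine h.trans ?_
  congr 2
  ext i
  conv_rhs => rw [pi_eq_sum_univ' x]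
  simp [mul_comm]

theorem isHomogeneous_linearSubst {M N d : ℕ} (φ : (Fin M → F) →ₗ[F] (Fin N → F))
    {G : MvPolynomial (Fin N) F} (hG : G.IsHomogeneous d) :
    (linearSubst φ G).IsHomogeneous d := by
  have := hG.aeval (S := F)
    (fun i => ∑ j, MvPolynomial.C (φ (Pi.single j 1) i) * MvPolynomial.X j) (n := 1)
    (fun i => MvPolynomial.IsHomogeneous.sum _ _ _ fun j _ =>
      MvPolynomial.isHomogeneous_C_mul_X _ _)
  simpa [linearSubst] using this

/-- A form of degree at most `Fintype.card F` that vanishes at every vector is zero, so the claim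
can be checked on values. -/
theorem linearSubst_ne_zero [Fintype F] {N d : ℕ} (φ : (Fin N → F) ≃ₗ[F] (Fin N → F))
    {G : MvPolynomial (Fin N) F} (hG : G.IsHomogeneous d) (hd : d ≤ Fintype.card F) (h0 : G ≠ 0) :
    linearSubst φ.toLinearMap G ≠ 0 := by
  intro h
  refine h0 (hG.eq_zero_of_forall_eval_eq_zero_of_le_card (fun r => ?_) (by simpa using hd))
  have := eval_linearSubst φ.toLinearMap G (φ.symm r)
  simpa [h] using this.symm

theorem isHomogeneous_hermitianForm (q : ℕ) {N : ℕ} (H : Matrix (Fin N) (Fin N) F) :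
    (hermitianForm q H).IsHomogeneous (q + 1) := by
  refine MvPolynomial.IsHomogeneous.sum _ _ _ fun i _ =>
    MvPolynomial.IsHomogeneous.sum _ _ _ fun j _ => ?_
  rw [add_comm]
  exact (MvPolynomial.isHomogeneous_C_mul_X _ _).mul (MvPolynomial.isHomogeneous_X_pow _ _)

end Forms

/-! ### Passing from projective points to vectors. -/

section Counting

variable {F : Type*} [Field F] [Fintype F]

open Classical in
/-- A set of projective points is counted by the nonzero vectors representing them. -/
theorem card_points_mul {N : ℕ} (p : (Fin N → F) → Prop)
    (hp : ∀ (c : F) (x : Fin N → F), c ≠ 0 → p x → p (c • x)) :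
    Nat.card {P : ℙ F (Fin N → F) | p (normRep P)} * (Fintype.card F - 1) =
      (Finset.univ.filter fun x : Fin N → F => x ≠ 0 ∧ p x).card := by
  have hu : Nat.card Fˣ = Fintype.card F - 1 := by
    rw [Nat.card_units, Nat.card_eq_fintype_card]
  rw [← hu, ← Nat.card_prod, ← Fintype.card_subtype, ← Nat.card_eq_fintype_card]
  -- Each nonzero vector is a unique unit multiple of the normalized representative of its point.
  refine Nat.card_congr (Equiv.ofBijective (fun a => ⟨(a.2 : F) • normRep a.1.1,
    smul_ne_zero a.2.ne_zero (normRep_ne_zero _), hp _ _ a.2.ne_zero a.1.2⟩) ⟨?_, ?_⟩)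
  · rintro ⟨⟨P, hP⟩, u⟩ ⟨⟨P', hP'⟩, u'⟩ h
    simp only [Subtype.mk.injEq] at h
    have hPP : P = P' := by
      rw [← mk_normRep P, ← mk_normRep P', Projectivization.mk_eq_mk_iff']
      refine ⟨(u : F)⁻¹ * u', ?_⟩
      rw [mul_smul, ← h, smul_smul, inv_mul_cancel₀ u.ne_zero, one_smul]
    subst hPP
    have := smul_left_injective F (normRep_ne_zero P) h
    simp [Units.ext_iff, this]
  · rintro ⟨x, hx, hpx⟩
    have h := mk_normRep (Projectivization.mk F x hx)
    rw [Projectivization.mk_eq_mk_iff] at h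
    obtain ⟨u, hu⟩ := h
    have hu' : (u : F) • x = normRep (Projectivization.mk F x hx) := hu
    refine ⟨⟨⟨Projectivization.mk F x hx, ?_⟩, u⁻¹⟩, ?_⟩
    · change p _
      rw [← hu']
      exact hp _ _ u.ne_zero hpx
    · ext1
      change ((u⁻¹ : Fˣ) : F) • normRep (Projectivization.mk F x hx) = x
      rw [← hu', smul_smul, Units.inv_mul, one_smul]

end Counting

/-! ### Hermitian matrices as sesquilinear forms. -/

section MatrixForm

variable {F : Type*} [Field F] {q : ℕ}

/-- The sesquilinear form of a matrix. -/
noncomputable def matrixForm (σ : F →+* F) {N : ℕ} (H : Matrix (Fin N) (Fin N) F) :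
    (Fin N → F) →ₗ[F] (Fin N → F) →ₛₗ[σ] F :=
  LinearMap.mk₂'ₛₗ (RingHom.id F) σ (fun x y => ∑ i, ∑ j, H i j * x i * σ (y j))
    (by intros; simp only [Pi.add_apply, mul_add, add_mul, Finset.sum_add_distrib])
    (by
      intros
      simp only [Pi.smul_apply, smul_eq_mul, RingHom.id_apply, Finset.mul_sum]
      exact Finset.sum_congr rfl fun i _ => Finset.sum_congr rfl fun j _ => by ring)
    (by intros; simp only [Pi.add_apply, map_add, mul_add, Finset.sum_add_distrib])
    (by
      intros
      simp only [Pi.smul_apply, smul_eq_mul, map_mul, Finset.mul_sum]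
      exact Finset.sum_congr rfl fun i _ => Finset.sum_congr rfl fun j _ => by ring)

theorem matrixForm_apply (σ : F →+* F) {N : ℕ} (H : Matrix (Fin N) (Fin N) F) (x y : Fin N → F) :
    matrixForm σ H x y = ∑ i, ∑ j, H i j * x i * σ (y j) := rfl

theorem eval_hermitianForm {σ : F →+* F} (hσ : ∀ x, σ x = x ^ q) {N : ℕ}
    (H : Matrix (Fin N) (Fin N) F) (x : Fin N → F) :
    MvPolynomial.eval x (hermitianForm q H) = matrixForm σ H x x := by
  simp [hermitianForm, matrixForm_apply, hσ]

theorem matrixForm_isHermitian {σ : F →+* F} [Fintype F] (hF : Fintype.card F = q ^ 2)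
    (hσ : ∀ x, σ x = x ^ q) {N : ℕ} {H : Matrix (Fin N) (Fin N) F}
    (hH : ∀ i j, H i j = H j i ^ q) : IsHermitianForm (matrixForm σ H) := by
  intro x y
  simp only [matrixForm_apply, map_sum, map_mul]
  rw [Finset.sum_comm]
  refine Finset.sum_congr rfl fun i _ => Finset.sum_congr rfl fun j _ => ?_
  rw [hH j i, hσ (H i j), hσ (σ (x j)), hσ (x j), pow_q_pow_q hF]
  ring

/-- A Hermitian matrix of rank `r` is congruent to `diag(1, …, 1, 0, …, 0)` with `r` ones. -/
theorem exists_linearEquiv_diagonal {σ : F →+* F} [Fintype F] (hF : Fintype.card F = q ^ 2)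
    (hσ : ∀ x, σ x = x ^ q) {N : ℕ} {H : Matrix (Fin N) (Fin N) F}
    (hH : ∀ i j, H i j = H j i ^ q) :
    ∃ φ : (Fin N → F) ≃ₗ[F] (Fin N → F), ∀ x,
      matrixForm σ H (φ x) (φ x) = ∑ i : Fin N, if (i : ℕ) < H.rank then x i ^ (q + 1) else 0 := by
  classical
  obtain ⟨r, b, hb⟩ := (matrixForm_isHermitian hF hσ hH).exists_basis hF hσ N
    (Module.finrank_fin_fun F)
  have hr : ∀ i : Fin N, (i : ℕ) < H.rank ↔ (i : ℕ) < r := by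
    let P : Matrix (Fin N) (Fin N) F := Matrix.of fun i j => b i j
    have hP : IsUnit P.det := by
      rw [← Matrix.isUnit_iff_isUnit_det, ← Matrix.linearIndependent_rows_iff_isUnit]
      exact b.linearIndependent
    have hP' : IsUnit (P.map σ).transpose.det := by
      rw [Matrix.det_transpose, ← RingHom.mapMatrix_apply, ← RingHom.map_det]
      exact hP.map σ
    -- The left side is the Gram matrix of the form in the basis `b`; the outer factors are
    -- invertible, so it has the rank of `H`.
    have hD : P * H * (P.map σ).transpose =
        Matrix.diagonal fun i : Fin N => if (i : ℕ) < r then (1 : F) else 0 := by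
      ext i j
      have := hb i j
      rw [matrixForm_apply] at this
      rw [Matrix.diagonal_apply, ← ite_and, ← this, Matrix.mul_apply, Finset.sum_comm]
      refine Finset.sum_congr rfl fun k _ => ?_
      rw [Matrix.mul_apply, Finset.sum_mul]
      refine Finset.sum_congr rfl fun l _ => ?_
      simp [P, mul_comm (H l k)]
    -- The diagonalization does not bound `r` by `N`, hence the minimum.
    have hrk : H.rank = min r N := by
      rw [← Matrix.rank_mul_eq_right_of_isUnit_det P H hP,
        ← Matrix.rank_mul_eq_left_of_isUnit_det _ _ hP', hD, Matrix.rank_diagonal]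
      simp only [ne_eq, ite_eq_right_iff, one_ne_zero, imp_false, not_not]
      rw [Fintype.card_subtype]
      rw [Fin.card_filter_val_lt, min_comm]
    intro i
    rw [hrk]
    have := i.2
    omega
  refine ⟨b.equivFun.symm, fun x => ?_⟩
  rw [b.equivFun_symm_apply]
  simp only [map_sum, map_smul, LinearMap.sum_apply, LinearMap.smul_apply, LinearMap.map_smulₛₗ, hb,
    smul_eq_mul]
  refine Finset.sum_congr rfl fun i _ => ?_
  rw [Finset.sum_eq_single i]
  · simp only [true_and, hr, hσ]
    split_ifs
    · ring
    · simp
  · intro j _ hj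
    simp [hj]
  · simp

end MatrixForm

/-- Counting tuples by their tails. -/
theorem card_filter_eq_sum_cons {F : Type*} [Fintype F] [DecidableEq F] {n : ℕ}
    (r : (Fin (n + 1) → F) → Prop) [DecidablePred r] :
    (Finset.univ.filter fun z : Fin (n + 1) → F => r z).card =
      ∑ x : Fin n → F, (Finset.univ.filter fun t : F => r (Fin.cons t x)).card := by
  rw [← Finset.card_sigma]
  refine Finset.card_bij' (fun z _ => ⟨Fin.tail z, z 0⟩) (fun a _ => Fin.cons a.2 a.1) ?_ ?_ ?_ ?_
  · intro z hz
    simpa using hz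
  · intro a ha
    simpa using ha
  · intro z _
    simp
  · rintro ⟨x, t⟩ _
    simp

/-! ### Geometry and point count of the standard Hermitian form. -/

section StandardForm

variable {F : Type*} [Field F] {q n : ℕ} {σ : F →+* F}

/-- The standard Hermitian form `∑ x_i ^ (q + 1)`. -/
def normSum (q : ℕ) {n : ℕ} (x : Fin n → F) : F := ∑ i, x i ^ (q + 1)

theorem matrixForm_one_apply (x y : Fin n → F) :
    matrixForm σ 1 x y = ∑ i, x i * σ (y i) := by
  simp [matrixForm_apply, Matrix.one_apply]

theorem matrixForm_one_self (hσ : ∀ x, σ x = x ^ q) (x : Fin n → F) :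
    matrixForm σ 1 x x = normSum q x := by
  simp only [matrixForm_one_apply, normSum, hσ, pow_succ']

theorem normSum_cons (t : F) (x : Fin n → F) :
    normSum q (Fin.cons t x : Fin (n + 1) → F) = t ^ (q + 1) + normSum q x := by
  simp [normSum, Fin.sum_univ_succ]

theorem normSum_zero : normSum q (0 : Fin n → F) = 0 := by simp [normSum]

theorem eq_zero_of_forall_matrixForm_one_eq_zero (z : Fin n → F)
    (h : ∀ u, matrixForm σ 1 u z = 0) : z = 0 := by
  ext i
  have := h (Pi.single i 1)
  simpa [matrixForm_one_apply, Pi.single_apply] using this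

theorem le_finrank_orthogonal (x : Fin n → F) :
    n ≤ Module.finrank F (LinearMap.ker ((matrixForm σ 1).flip x)) + 1 := by
  have h := LinearMap.finrank_range_add_finrank_ker ((matrixForm σ 1).flip x)
  rw [Module.finrank_fin_fun] at h
  have h2 := Submodule.finrank_le (LinearMap.range ((matrixForm σ 1).flip x))
  rw [Module.finrank_self] at h2
  omega

variable [Fintype F]

theorem matrixForm_one_isHermitian (hF : Fintype.card F = q ^ 2) (hσ : ∀ x, σ x = x ^ q) :
    IsHermitianForm (matrixForm σ (1 : Matrix (Fin n) (Fin n) F)) := by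
  have hq := two_le_of_card_eq_sq hF
  refine matrixForm_isHermitian hF hσ fun i j => ?_
  by_cases h : i = j
  · rw [h, Matrix.one_apply_eq, one_pow]
  · rw [Matrix.one_apply_ne h, Matrix.one_apply_ne (Ne.symm h), zero_pow (by omega)]

theorem normSum_pow (hF : Fintype.card F = q ^ 2) (x : Fin n → F) :
    normSum q x ^ q = normSum q x := by
  obtain ⟨σ, hσ⟩ := exists_ringHom_eq_pow hF
  rw [← matrixForm_one_self hσ]
  exact (matrixForm_one_isHermitian hF hσ).self_pow hσ x

/-- If all vectors orthogonal to `x` are isotropic then they are multiples of `x`. -/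
theorem orthogonal_le_span (hF : Fintype.card F = q ^ 2) (hσ : ∀ x, σ x = x ^ q)
    {x : Fin n → F} (hx : x ≠ 0)
    (h : ∀ z, matrixForm σ 1 z x = 0 → matrixForm σ 1 z z = 0) :
    LinearMap.ker ((matrixForm σ 1).flip x) ≤ Submodule.span F {x} := by
  set B := matrixForm σ (1 : Matrix (Fin n) (Fin n) F) with hBdef
  have hB : IsHermitianForm B := matrixForm_one_isHermitian hF hσ
  have hmem : ∀ z, z ∈ LinearMap.ker (B.flip x) ↔ B z x = 0 := fun z => by simp
  intro z hz
  obtain ⟨y₀, hy₀⟩ : ∃ y, B y x ≠ 0 := by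
    by_contra! hcon
    exact hx (eq_zero_of_forall_matrixForm_one_eq_zero x hcon)
  obtain ⟨y, hy⟩ : ∃ y, B y x = 1 := ⟨(B y₀ x)⁻¹ • y₀, by simp [hy₀]⟩
  -- Every `u` differs from a multiple of `y` by a vector orthogonal to `x`, and such a vector is
  -- orthogonal to `z`. So the values on all `u` are determined by the one on `y`, and subtracting
  -- this multiple of `x` cancels them.
  have hzero : z - σ (B y z) • x = 0 := by
    refine eq_zero_of_forall_matrixForm_one_eq_zero (σ := σ) _ fun u => ?_
    have h1 : B (u - B u x • y) z = 0 :=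
      hB.eq_zero_of_self_eq_zero hF hσ (LinearMap.ker (B.flip x))
        (fun w hw => h w ((hmem w).1 hw)) ((hmem _).2 (by simp [hy])) hz
    rw [← hBdef]
    simp only [map_sub, LinearMap.sub_apply, map_smul, LinearMap.smul_apply, smul_eq_mul,
      LinearMap.map_smulₛₗ] at h1 ⊢
    rw [hσ (σ _), hσ (B y z), pow_q_pow_q hF]
    linear_combination h1
  rw [sub_eq_zero.1 hzero]
  exact Submodule.smul_mem _ _ (Submodule.mem_span_singleton_self x)

/-- Otherwise the orthogonal complement of `x`, of dimension at least `n - 1 ≥ 2`, would lie on the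
line through `x`. -/
theorem exists_orthogonal_of_isotropic (hF : Fintype.card F = q ^ 2) (hσ : ∀ x, σ x = x ^ q)
    (hn : 3 ≤ n) {x : Fin n → F} (hx : x ≠ 0) :
    ∃ v, matrixForm σ 1 v x = 0 ∧ matrixForm σ 1 v v ≠ 0 := by
  by_contra! h
  have h1 := Submodule.finrank_mono (orthogonal_le_span hF hσ hx h)
  have h2 := le_finrank_orthogonal (σ := σ) x
  rw [finrank_span_singleton hx] at h1
  omega

/-- Otherwise the orthogonal complement would lie in the span of `x`, which it meets only in `0`;
but its dimension is at least `n - 1 ≥ 1`. -/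
theorem exists_orthogonal_of_anisotropic (hF : Fintype.card F = q ^ 2) (hσ : ∀ x, σ x = x ^ q)
    (hn : 2 ≤ n) {x : Fin n → F} (hx : matrixForm σ 1 x x ≠ 0) :
    ∃ v, matrixForm σ 1 v x = 0 ∧ matrixForm σ 1 v v ≠ 0 := by
  by_contra! h
  have hx0 : x ≠ 0 := by rintro rfl; simp at hx
  have h1 := orthogonal_le_span hF hσ hx0 h
  have h2 := le_finrank_orthogonal (σ := σ) x
  have h3 : LinearMap.ker ((matrixForm σ 1).flip x) = ⊥ := by
    rw [eq_bot_iff]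
    intro z hz
    obtain ⟨c, rfl⟩ := Submodule.mem_span_singleton.1 (h1 hz)
    simp only [LinearMap.mem_ker, LinearMap.flip_apply, map_smul, smul_eq_mul, mul_eq_zero, hx, or_false] at hz
    simp [hz]
  rw [h3, finrank_bot] at h2
  omega

/-- A nonzero form of degree at most `q` does not vanish on a non-degenerate Hermitian variety. -/
theorem exists_isotropic_eval_ne_zero (hF : Fintype.card F = q ^ 2) (hn : 2 ≤ n) {d : ℕ}
    (hd : d ≤ q) {g : MvPolynomial (Fin n) F} (hg : g.IsHomogeneous d) (hg0 : g ≠ 0) :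
    ∃ x, x ≠ 0 ∧ normSum q x = 0 ∧ MvPolynomial.eval x g ≠ 0 := by
  classical
  obtain ⟨σ, hσ⟩ := exists_ringHom_eq_pow hF
  have hq := two_le_of_card_eq_sq hF
  by_contra! h
  apply hg0
  have key : ∀ x, matrixForm σ 1 x x ≠ 0 → MvPolynomial.eval x g = 0 := by
    intro x hx
    obtain ⟨v, hvx, hv⟩ := exists_orthogonal_of_anisotropic hF hσ hn hx
    have hB : IsHermitianForm (matrixForm σ (1 : Matrix (Fin n) (Fin n) F)) :=
      matrixForm_one_isHermitian hF hσ
    have hxv : matrixForm σ 1 x v = 0 := by rw [hB, hvx, map_zero]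
    let p : Polynomial F := MvPolynomial.aeval
      (fun i => Polynomial.C (x i) + Polynomial.C (v i) * Polynomial.X) g
    have hp : ∀ t, p.eval t = MvPolynomial.eval (x + t • v) g := by
      intro t
      rw [← Polynomial.coe_aeval_eq_eval]
      refine (MvPolynomial.comp_aeval_apply _ (Polynomial.aeval t) g).trans ?_
      rw [MvPolynomial.aeval_eq_eval]
      congr 2
      ext i
      rw [map_add, map_mul, Polynomial.aeval_C, Polynomial.aeval_C, Polynomial.aeval_X,
        Pi.add_apply, Pi.smul_apply, smul_eq_mul, mul_comm]
      rfl
    have hpdeg : p.natDegree ≤ d * 1 := MvPolynomial.aeval_natDegree_le g hg.totalDegree_le _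
      fun i => by compute_degree
    -- The vector `x + t v` is isotropic exactly when `t ^ (q + 1) = c`. This has `q + 1 > d`
    -- solutions, so `g` vanishes along the whole line and in particular at `t = 0`.
    set c := -(matrixForm σ 1 x x) / matrixForm σ 1 v v with hc
    have hc0 : c ≠ 0 := div_ne_zero (neg_ne_zero.2 hx) hv
    have hcq : c ^ q = c := by
      rw [← hσ, hc, map_div₀, map_neg, ← hB, ← hB]
    have hcard := card_norm_fiber hF hc0 hcq
    have hp0 : p = 0 := by
      refine Polynomial.eq_zero_of_natDegree_lt_card_of_eval_eq_zero' p
        (Finset.univ.filter fun t : F => t ^ (q + 1) = c) (fun t ht => ?_) (by omega)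
      rw [Finset.mem_filter] at ht
      rw [hp]
      refine h _ (fun h0 => ?_) ?_
      · have := congrArg (fun z => matrixForm σ 1 z x) h0
        simp [hvx, hx] at this
      · rw [← matrixForm_one_self hσ]
        simp only [map_add, map_smul, LinearMap.add_apply, LinearMap.smul_apply, smul_eq_mul,
          LinearMap.map_smulₛₗ, hvx, hxv, hσ]
        have h1 : t ^ (q + 1) * matrixForm σ 1 v v = -matrixForm σ 1 x x := by
          rw [ht.2, hc, div_mul_cancel₀ _ hv]
        linear_combination h1
    have := hp 0
    rw [hp0] at this
    simpa using this.symm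
  refine hg.eq_zero_of_forall_eval_eq_zero_of_le_card (fun x => ?_) ?_
  · by_cases hx : matrixForm σ 1 x x = 0
    · by_cases hx0 : x = 0
      -- The value at `0` is `0 ^ d` times the value at an anisotropic unit vector, which also
      -- covers `d = 0`.
      · let i₀ : Fin n := ⟨0, by omega⟩
        have h1 := key (Pi.single i₀ 1) (by simp [matrixForm_one_apply, Pi.single_apply])
        have h2 := eval_smul_of_isHomogeneous hg 0 (Pi.single i₀ 1)
        rw [h1, mul_zero, zero_smul] at h2
        rw [hx0, h2]
      · exact h x hx0 (by rw [← matrixForm_one_self hσ, hx])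
    · exact key x hx
  · rw [Cardinal.mk_fintype, hF]
    exact_mod_cast hd.trans (by nlinarith)

open Classical in
-- Over a tail `x` the equation `t ^ (q + 1) = -normSum q x` has one solution if `x` is isotropic
-- and `q + 1` otherwise.
theorem card_isotropic_succ (hF : Fintype.card F = q ^ 2) (n : ℕ) :
    (Finset.univ.filter fun x : Fin (n + 1) → F => normSum q x = 0).card +
      q * (Finset.univ.filter fun x : Fin n → F => normSum q x = 0).card =
      (q + 1) * (q ^ 2) ^ n := by
  have hq := two_le_of_card_eq_sq hF
  obtain ⟨σ, hσ⟩ := exists_ringHom_eq_pow hF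
  have h1 : (Finset.univ.filter fun x : Fin (n + 1) → F => normSum q x = 0).card =
      ∑ x : Fin n → F, (Finset.univ.filter fun t : F => t ^ (q + 1) = -normSum q x).card := by
    rw [card_filter_eq_sum_cons]
    simp only [normSum_cons, add_eq_zero_iff_eq_neg]
  have h2 : ∀ x : Fin n → F, (Finset.univ.filter fun t : F => t ^ (q + 1) = -normSum q x).card +
      q * (if normSum q x = 0 then 1 else 0) = q + 1 := by
    intro x
    split_ifs with h
    · rw [h]
      have : (Finset.univ.filter fun t : F => t ^ (q + 1) = -0) = {0} := by
        ext t
        simp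
      rw [this]
      simp
      ring
    · rw [card_norm_fiber hF (neg_ne_zero.2 h)]
      · simp
      · rw [← hσ, map_neg, hσ, normSum_pow hF]
  rw [h1, Finset.card_filter, Finset.mul_sum, ← Finset.sum_add_distrib,
    Finset.sum_congr rfl fun x _ => h2 x]
  simp [hF, mul_comm]

open Classical in
theorem card_isotropic (hF : Fintype.card F = q ^ 2) (n : ℕ) :
    (q : ℤ) * (Finset.univ.filter fun x : Fin n → F => normSum q x = 0).card =
      q ^ (2 * n) + (-1) ^ n * (q - 1) * q ^ n := by
  induction n with
  | zero => simp [normSum, Finset.filter_true_of_mem]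
  | succ n ih =>
    have h := congrArg (Nat.cast (R := ℤ)) (card_isotropic_succ hF n)
    push_cast at h
    rw [← pow_mul] at h
    have e1 : (q : ℤ) ^ (2 * (n + 1)) = q ^ 2 * q ^ (2 * n) := by ring
    rw [e1]
    linear_combination (q : ℤ) * h - (q : ℤ) * ih

open Classical in
theorem card_isotropic_ne_zero (n : ℕ) :
    (Finset.univ.filter fun x : Fin n → F => x ≠ 0 ∧ normSum q x = 0).card + 1 =
      (Finset.univ.filter fun x : Fin n → F => normSum q x = 0).card := by
  have : (Finset.univ.filter fun x : Fin n → F => normSum q x = 0) =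
      insert 0 (Finset.univ.filter fun x : Fin n → F => x ≠ 0 ∧ normSum q x = 0) := by
    ext x
    by_cases hx : x = 0 <;> simp [hx, normSum_zero]
  rw [this, Finset.card_insert_of_notMem (by simp)]

open Classical in
/-- The number of nonzero isotropic vectors of the standard Hermitian form. -/
theorem card_isotropic_eq (hF : Fintype.card F = q ^ 2) (n : ℕ) :
    ((Finset.univ.filter fun x : Fin (n + 1) → F => x ≠ 0 ∧ normSum q x = 0).card : ℤ) =
      (q ^ n - (-1) ^ n) * (q ^ (n + 1) - (-1) ^ (n + 1)) := by
  have hq := two_le_of_card_eq_sq hF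
  have h1 := card_isotropic hF (n + 1)
  rw [← card_isotropic_ne_zero] at h1
  have hq0 : (q : ℤ) ≠ 0 := by positivity
  apply mul_left_cancel₀ hq0
  push_cast at h1
  have e : ((-1 : ℤ) ^ n) ^ 2 = 1 := by rw [← pow_mul, mul_comm, pow_mul]; simp
  have e1 : (q : ℤ) ^ (2 * (n + 1)) = q ^ 2 * (q ^ n) ^ 2 := by ring
  rw [e1] at h1
  linear_combination h1 + (q : ℤ) * e

end StandardForm

/-! ### Hypersurface sections of a non-degenerate Hermitian variety. -/

section Sections

variable {F : Type*} [Field F] [Fintype F] {q n : ℕ}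

open Classical in
/-- A set of vectors disjoint from `K`, with at most `c` elements in each coset of `K`. -/
theorem card_le_of_card_cosets_le (K : Submodule F (Fin n → F)) {k : ℕ}
    (hk : Module.finrank F K = k) (S : Finset (Fin n → F)) (hS : ∀ x ∈ S, x ∉ K) (c : ℕ)
    (hc : ∀ w, (S.filter fun x => x - w ∈ K).card ≤ c) :
    S.card ≤ c * (Fintype.card F ^ (n - k) - 1) := by
  have : Fintype ((Fin n → F) ⧸ K) := Fintype.ofFinite _
  have hcard : (Finset.univ.erase (0 : (Fin n → F) ⧸ K)).card = Fintype.card F ^ (n - k) - 1 := by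
    have h := Submodule.finrank_quotient_add_finrank K
    rw [Module.finrank_fin_fun, hk] at h
    rw [Finset.card_erase_of_mem (Finset.mem_univ _), Finset.card_univ,
      Module.card_eq_pow_finrank (K := F), Nat.eq_sub_of_add_eq h]
  rw [← hcard]
  refine Finset.card_le_mul_card_image_of_maps_to (f := K.mkQ) ?_ c ?_
  · intro x hx
    simpa using hS x hx
  · intro b _
    obtain ⟨w, rfl⟩ := K.mkQ_surjective b
    convert hc w using 4 with x
    simp [Submodule.Quotient.eq]

open Classical in
/-- Bound for the number of points in which a form of degree `e` meets a non-degenerate Hermitian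
variety of positive dimension. -/
theorem card_section_le (hF : Fintype.card F = q ^ 2) (hn : 3 ≤ n) {e : ℕ}
    (heq : e ≤ q) {g : MvPolynomial (Fin n) F} (hg : g.IsHomogeneous e) (hg0 : g ≠ 0) :
    (Finset.univ.filter fun x : Fin n → F =>
      x ≠ 0 ∧ normSum q x = 0 ∧ MvPolynomial.eval x g = 0).card ≤
      e * (q + 1) * ((q ^ 2) ^ (n - 2) - 1) := by
  obtain ⟨σ, hσ⟩ := exists_ringHom_eq_pow hF
  have hq := two_le_of_card_eq_sq hF
  obtain ⟨P, hP0, hPn, hPg⟩ := exists_isotropic_eval_ne_zero hF (by omega) heq hg hg0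
  obtain ⟨v, hvP, hv⟩ := exists_orthogonal_of_isotropic hF hσ hn hP0
  have hB : IsHermitianForm (matrixForm σ (1 : Matrix (Fin n) (Fin n) F)) :=
    matrixForm_one_isHermitian hF hσ
  have hPv : matrixForm σ 1 P v = 0 := by rw [hB, hvP, map_zero]
  have hPP : matrixForm σ 1 P P = 0 := by rw [matrixForm_one_self hσ, hPn]
  have hK : Module.finrank F (Submodule.span F {P, v}) = 2 := by
    have hli : LinearIndependent F ![P, v] := by
      rw [LinearIndependent.pair_iff]
      intro s t hst
      have h1 := congrArg (fun z => matrixForm σ 1 z v) hst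
      simp only [map_add, map_smul, LinearMap.add_apply, LinearMap.smul_apply, hPv, mul_zero,
        zero_add, map_zero, LinearMap.zero_apply, smul_eq_mul, mul_eq_zero, hv, or_false] at h1
      subst h1
      simpa [hP0] using hst
    have h := finrank_span_eq_card hli
    rwa [Matrix.range_cons_cons_empty, Fintype.card_fin] at h
  rw [← hF]
  refine card_le_of_card_cosets_le (Submodule.span F {P, v}) hK _ ?_ _ ?_
  -- On the plane `⟨P, v⟩` isotropy kills the `v`-coordinate, and `g(P) ≠ 0` then kills the multiple
  -- of `P`.
  · intro x hx hxK
    simp only [Finset.mem_filter, Finset.mem_univ, true_and] at hx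
    obtain ⟨hx0, hxn, hxg⟩ := hx
    obtain ⟨a, b, rfl⟩ := Submodule.mem_span_pair.1 hxK
    rw [← matrixForm_one_self hσ] at hxn
    simp only [map_add, map_smul, LinearMap.add_apply, LinearMap.smul_apply, hPv, hPP, hvP,
      mul_zero, zero_add, LinearMap.map_smulₛₗ, smul_eq_mul, mul_eq_zero, hv, or_false,
      add_zero, map_eq_zero, or_self] at hxn
    subst hxn
    rw [zero_smul, add_zero] at hx0 hxg
    rw [eval_smul_of_isHomogeneous hg, mul_eq_zero, or_iff_left hPg] at hxg
    rw [eq_zero_of_pow_eq_zero hxg, zero_smul] at hx0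
    exact hx0 rfl
  · intro w
    set S := Finset.univ.filter fun x : Fin n → F =>
      x ≠ 0 ∧ normSum q x = 0 ∧ MvPolynomial.eval x g = 0 with hS
    let Z : Finset (F × F) := Finset.univ.filter fun z => w + z.1 • P + z.2 • v ∈ S
    have hZmem : ∀ z ∈ Z, w + z.1 • P + z.2 • v ∈ S := fun z hz => (Finset.mem_filter.1 hz).2
    have hsub : S.filter (fun x => x - w ∈ Submodule.span F {P, v}) ⊆
        Z.image fun z => w + z.1 • P + z.2 • v := by
      intro x hx
      obtain ⟨hxS, hxK⟩ := Finset.mem_filter.1 hx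
      obtain ⟨a, b, hab⟩ := Submodule.mem_span_pair.1 hxK
      have hx' : w + a • P + b • v = x := by rw [add_assoc, hab]; abel
      exact Finset.mem_image.2 ⟨(a, b), Finset.mem_filter.2 ⟨Finset.mem_univ _, hx' ▸ hxS⟩, hx'⟩
    refine (Finset.card_le_card hsub).trans (Finset.card_image_le.trans ?_)
    refine card_le_of_eval_eq_zero hg hPg Z
      (fun z hz => (Finset.mem_filter.1 (hZmem z hz)).2.2.2) ?_
    set Y : Z → F := fun z => z.1.1 with hY
    set T : Z → F := fun z => z.1.2 with hT
    set β := matrixForm σ 1 v v with hβ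
    -- This is the Hermitian equation on the coset. As `P` is isotropic and orthogonal to `v`, the
    -- only term of degree `q + 1` is `β T ^ (q + 1)`.
    have hrel : T ^ (q + 1) = (-β⁻¹ * matrixForm σ 1 v w) • (Y ^ 0 * T ^ 1) +
        (-β⁻¹ * matrixForm σ 1 w v) • (Y ^ 0 * T ^ q) +
        (-β⁻¹ * matrixForm σ 1 P w) • (Y ^ 1 * T ^ 0) +
        (-β⁻¹ * matrixForm σ 1 w P) • (Y ^ q * T ^ 0) +
        (-β⁻¹ * matrixForm σ 1 w w) • (Y ^ 0 * T ^ 0) := by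
      ext z
      have h1 := (Finset.mem_filter.1 (hZmem z.1 z.2)).2.2.1
      rw [← matrixForm_one_self hσ] at h1
      simp only [map_add, map_smul, LinearMap.add_apply, LinearMap.smul_apply, hPv, hPP, hvP,
        mul_zero, LinearMap.map_smulₛₗ, smul_eq_mul, add_zero, ← hβ, hσ] at h1
      simp only [hY, hT, Pi.add_apply, Pi.smul_apply, Pi.pow_apply, smul_eq_mul,
        pow_zero, Pi.one_apply, pow_one, one_mul, mul_one]
      field_simp
      linear_combination h1
    rw [hrel]
    refine Submodule.add_mem _ (Submodule.add_mem _ (Submodule.add_mem _ (Submodule.add_mem _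
      ?_ ?_) ?_) ?_) ?_ <;>
    refine Submodule.smul_mem _ _ (mem_monomialSpan ?_) <;>
    rw [Set.mem_ofPred_eq] <;> dsimp only <;> omega

open Classical in
/-- A binary form of degree `e ≤ q` has at most `e` zeros on a non-degenerate Hermitian variety. -/
theorem card_section_le_of_two (hF : Fintype.card F = q ^ 2) {e : ℕ}
    (heq : e ≤ q) {g : MvPolynomial (Fin 2) F} (hg : g.IsHomogeneous e) (hg0 : g ≠ 0) :
    (Finset.univ.filter fun x : Fin 2 → F =>
      x ≠ 0 ∧ normSum q x = 0 ∧ MvPolynomial.eval x g = 0).card ≤ e * (q ^ 2 - 1) := by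
  obtain ⟨P, hP0, hPn, hPg⟩ := exists_isotropic_eval_ne_zero hF le_rfl heq hg hg0
  have hK := finrank_span_singleton (K := F) hP0
  have key := card_le_of_card_cosets_le (Submodule.span F {P}) hK
    (Finset.univ.filter fun x : Fin 2 → F =>
      x ≠ 0 ∧ normSum q x = 0 ∧ MvPolynomial.eval x g = 0) ?_ e ?_
  · simpa [hF] using key
  · intro x hx hxK
    simp only [Finset.mem_filter, Finset.mem_univ, true_and] at hx
    obtain ⟨hx0, hxn, hxg⟩ := hx
    obtain ⟨a, rfl⟩ := Submodule.mem_span_singleton.1 hxK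
    rw [eval_smul_of_isHomogeneous hg, mul_eq_zero, or_iff_left hPg] at hxg
    rw [eq_zero_of_pow_eq_zero hxg, zero_smul] at hx0
    exact hx0 rfl
  · intro w
    set S := Finset.univ.filter fun x : Fin 2 → F =>
      x ≠ 0 ∧ normSum q x = 0 ∧ MvPolynomial.eval x g = 0 with hS
    -- Fixing the second coordinate at `0` supplies the relation `s ^ 1 = 0`, so the plane bound
    -- applies to a line with `m = 1`.
    let Z : Finset (F × F) := Finset.univ.filter fun z => z.2 = 0 ∧ w + z.1 • P + z.2 • 0 ∈ S
    have hZmem : ∀ z ∈ Z, z.2 = 0 ∧ w + z.1 • P + z.2 • 0 ∈ S :=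
      fun z hz => (Finset.mem_filter.1 hz).2
    have hsub : S.filter (fun x => x - w ∈ Submodule.span F {P}) ⊆
        Z.image fun z => w + z.1 • P + z.2 • 0 := by
      intro x hx
      obtain ⟨hxS, hxK⟩ := Finset.mem_filter.1 hx
      obtain ⟨a, hab⟩ := Submodule.mem_span_singleton.1 hxK
      have hx' : w + a • P + (0 : F) • (0 : Fin 2 → F) = x := by rw [add_assoc, hab]; simp
      exact Finset.mem_image.2
        ⟨(a, 0), Finset.mem_filter.2 ⟨Finset.mem_univ _, rfl, hx' ▸ hxS⟩, hx'⟩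
    refine (Finset.card_le_card hsub).trans (Finset.card_image_le.trans ?_)
    rw [← mul_one e]
    refine card_le_of_eval_eq_zero hg hPg Z
      (fun z hz => (Finset.mem_filter.1 (hZmem z hz).2).2.2.2) ?_
    have : (fun z : Z => z.1.2) = 0 := funext fun z => (hZmem z.1 z.2).1
    rw [this, pow_one]
    exact Submodule.zero_mem _

end Sections

/-! ### Counting on the cone along lines through the vertex. -/

section Cone

variable {F : Type*} [Field F] [Fintype F] {q n : ℕ}

open Classical in
theorem card_cone_isotropic (hF : Fintype.card F = q ^ 2) :
    (Finset.univ.filter fun z : Fin (n + 1) → F => z ≠ 0 ∧ normSum q (Fin.tail z) = 0).card + 1 =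
      q ^ 2 * (Finset.univ.filter fun x : Fin n → F => normSum q x = 0).card := by
  have h : (Finset.univ.filter fun z : Fin (n + 1) → F => normSum q (Fin.tail z) = 0) =
      insert 0 (Finset.univ.filter
        fun z : Fin (n + 1) → F => z ≠ 0 ∧ normSum q (Fin.tail z) = 0) := by
    ext z
    by_cases hz : z = 0
    · subst hz
      have h0 : Fin.tail (0 : Fin (n + 1) → F) = 0 := rfl
      simp [h0, normSum_zero]
    · simp [hz]
  rw [← Finset.card_insert_of_notMem (a := 0) (by simp), ← h, card_filter_eq_sum_cons, Finset.card_filter,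
    Finset.mul_sum]
  refine Finset.sum_congr rfl fun x _ => ?_
  simp only [Fin.tail_cons]
  split_ifs with hx <;> simp [hx, hF]

open Classical in
/-- Points of the cone on which a form vanishes, in terms of its leading coefficient in the
direction of the vertex. -/
theorem card_cone_section_le (hF : Fintype.card F = q ^ 2) {d : ℕ}
    {G : MvPolynomial (Fin (n + 1)) F} (hG : G.IsHomogeneous d) (hG0 : G ≠ 0) :
    ∃ (j e : ℕ) (g : MvPolynomial (Fin n) F), j + e = d ∧ g.IsHomogeneous e ∧ g ≠ 0 ∧
      (∀ x, MvPolynomial.eval x g ≠ 0 →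
        (Finset.univ.filter fun t : F =>
          MvPolynomial.eval (Fin.cons t x : Fin (n + 1) → F) G = 0).card ≤ j) ∧
      (Finset.univ.filter fun z : Fin (n + 1) → F =>
        z ≠ 0 ∧ normSum q (Fin.tail z) = 0 ∧ MvPolynomial.eval z G = 0).card +
      j * (Finset.univ.filter fun x : Fin n → F =>
        x ≠ 0 ∧ normSum q x = 0 ∧ MvPolynomial.eval x g = 0).card ≤
      (if e = 0 then 0 else q ^ 2 - 1) +
      q ^ 2 * (Finset.univ.filter fun x : Fin n → F =>
        x ≠ 0 ∧ normSum q x = 0 ∧ MvPolynomial.eval x g = 0).card +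
      j * (Finset.univ.filter fun x : Fin n → F => x ≠ 0 ∧ normSum q x = 0).card := by
  set p := MvPolynomial.finSuccEquiv F n G with hp
  have hp0 : p ≠ 0 := by simpa [hp] using hG0
  have hjd : p.natDegree ≤ d := by
    rw [hp, MvPolynomial.natDegree_finSuccEquiv]
    exact (MvPolynomial.degreeOf_le_totalDegree _ _).trans hG.totalDegree_le
  have heval : ∀ x t, MvPolynomial.eval (Fin.cons t x : Fin (n + 1) → F) G =
      (p.map (MvPolynomial.eval x)).eval t := fun x t => MvPolynomial.eval_eq_eval_mv_eval' x t G
  have hroots : ∀ x, MvPolynomial.eval x p.leadingCoeff ≠ 0 →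
      (Finset.univ.filter fun t : F =>
        MvPolynomial.eval (Fin.cons t x : Fin (n + 1) → F) G = 0).card ≤ p.natDegree := by
    intro x hx
    have hpx : p.map (MvPolynomial.eval x) ≠ 0 := by
      intro h0
      have := congrArg (fun r => Polynomial.coeff r p.natDegree) h0
      simp only [Polynomial.coeff_map, Polynomial.coeff_natDegree, Polynomial.coeff_zero] at this
      exact hx this
    refine le_trans ?_ ((Polynomial.card_roots' (p.map (MvPolynomial.eval x))).trans
      Polynomial.natDegree_map_le)
    refine le_trans (Finset.card_le_card ?_) (Multiset.toFinset_card_le _)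
    intro t ht
    rw [Finset.mem_filter, heval] at ht
    simp [hpx, ht.2]
  have hlead : p.leadingCoeff.IsHomogeneous (d - p.natDegree) :=
    hG.finSuccEquiv_coeff_isHomogeneous _ _ (by omega)
  refine ⟨p.natDegree, d - p.natDegree, p.leadingCoeff, by omega, hlead,
    Polynomial.leadingCoeff_ne_zero.2 hp0, hroots, ?_⟩
  set g := p.leadingCoeff
  set j := p.natDegree with hj
  set e := d - j with he
  -- The inequality is proved tail by tail and then summed. Adding `j` on the left for zeros of `g`
  -- avoids subtracting them from the isotropic tails on the right.
  have hfib : ∀ x : Fin n → F, (Finset.univ.filter fun t : F => (Fin.cons t x : Fin (n + 1) → F) ≠ 0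
      ∧ normSum q (Fin.tail (Fin.cons t x : Fin (n + 1) → F)) = 0 ∧
        MvPolynomial.eval (Fin.cons t x : Fin (n + 1) → F) G = 0).card +
      j * (if x ≠ 0 ∧ normSum q x = 0 ∧ MvPolynomial.eval x g = 0 then 1 else 0) ≤
      (if x = 0 then (if e = 0 then 0 else q ^ 2 - 1) else 0) +
      q ^ 2 * (if x ≠ 0 ∧ normSum q x = 0 ∧ MvPolynomial.eval x g = 0 then 1 else 0) +
      j * (if x ≠ 0 ∧ normSum q x = 0 then 1 else 0) := by
    intro x
    have hle : ∀ (r : F → Prop) [DecidablePred r], (Finset.univ.filter r).card ≤ q ^ 2 := by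
      intro r _
      rw [← hF]
      exact Finset.card_le_univ _
    by_cases hx : x = 0
    · subst hx
      simp only [ne_eq, not_true_eq_false, false_and, if_false, if_true, mul_zero, add_zero]
      -- The tail `0` carries the multiples of the vertex. If `e = 0`, then `g` is a nonzero
      -- constant and `G` equals this constant times `t ^ d` there, so it has no nonzero root.
      split_ifs with he0
      · rw [Nat.le_zero, Finset.card_eq_zero, Finset.filter_eq_empty_iff]
        rintro t - ⟨h1, -, h3⟩
        have ht : t ≠ 0 := by
          rintro rfl
          exact h1 (by ext i; refine Fin.cases ?_ (fun i => ?_) i <;> simp)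
        have hcst : MvPolynomial.eval (0 : Fin n → F) g ≠ 0 := by
          have hg0 : g.IsHomogeneous 0 := he0 ▸ hlead
          have hgC := MvPolynomial.totalDegree_eq_zero_iff_eq_C.1
            (Nat.le_zero.1 hg0.totalDegree_le)
          rw [hgC, MvPolynomial.eval_C]
          intro h0
          rw [h0, map_zero] at hgC
          exact Polynomial.leadingCoeff_ne_zero.2 hp0 hgC
        have hall : ∀ s : F, MvPolynomial.eval (Fin.cons s 0 : Fin (n + 1) → F) G = 0 := by
          intro s
          have : (Fin.cons s 0 : Fin (n + 1) → F) =
              (s / t) • (Fin.cons t 0 : Fin (n + 1) → F) := by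
            ext i
            refine Fin.cases ?_ (fun i => ?_) i <;> simp [ht]
          rw [this, eval_smul_of_isHomogeneous hG, h3, mul_zero]
        have hz : p.map (MvPolynomial.eval 0) = Polynomial.C
            (MvPolynomial.eval 0 g) * Polynomial.X ^ d := by
          ext i
          rw [Polynomial.coeff_map, Polynomial.coeff_C_mul_X_pow]
          split_ifs with hi
          · have : i = j := by omega
            rw [this]
            rfl
          · by_cases hid : i ≤ d
            · have hh : (p.coeff i).IsHomogeneous (d - i) :=
                hG.finSuccEquiv_coeff_isHomogeneous i (d - i) (by omega)
              have := eval_smul_of_isHomogeneous hh 0 0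
              rwa [zero_pow (by omega), zero_mul, smul_zero] at this
            · rw [Polynomial.coeff_eq_zero_of_natDegree_lt (by omega), map_zero]
        have h1 := hall 1
        rw [heval, hz] at h1
        rw [Polynomial.eval_C_mul, Polynomial.eval_pow, Polynomial.eval_X, one_pow, mul_one] at h1
        exact hcst h1
      · rw [← hF, ← Finset.card_univ, ← Finset.card_erase_of_mem (Finset.mem_univ (0 : F))]
        refine Finset.card_le_card fun t ht => ?_
        rw [Finset.mem_filter] at ht
        refine Finset.mem_erase.2 ⟨?_, Finset.mem_univ _⟩
        rintro rfl
        exact ht.2.1 (by ext i; refine Fin.cases ?_ (fun i => ?_) i <;> simp)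
    by_cases hn : normSum q x = 0
    · by_cases hgx : MvPolynomial.eval x g = 0
      · simp only [ne_eq, hx, hn, hgx, not_false_eq_true, and_true, if_true, if_false,
          mul_one]
        refine (Nat.add_le_add_right (hle _) _).trans ?_
        omega
      · simp only [ne_eq, hx, hn, hgx, not_false_eq_true, and_false, if_true, if_false,
          mul_one, mul_zero, add_zero, zero_add, and_self]
        refine le_trans (Finset.card_le_card ?_) (hroots x hgx)
        exact Finset.monotone_filter_right _ fun t _ ht => ht.2.2
    · simp [hn]
  rw [card_filter_eq_sum_cons]
  have h1 := Finset.sum_le_sum fun x (_ : x ∈ (Finset.univ : Finset (Fin n → F))) => hfib x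
  simp only [Finset.sum_add_distrib, ← Finset.mul_sum, ← Finset.card_filter] at h1
  simpa using h1

end Cone

/-! ### Transfer between Hermitian varieties and their standard forms. -/

section Transfer

variable {F : Type*} [Field F] [Fintype F] {q n : ℕ}

theorem exists_linearEquiv_normSum (hF : Fintype.card F = q ^ 2) {H : Matrix (Fin n) (Fin n) F}
    (hH : IsHermitianMatrix q H) (hrank : H.rank = n) :
    ∃ φ : (Fin n → F) ≃ₗ[F] (Fin n → F), ∀ x,
      MvPolynomial.eval (φ x) (hermitianForm q H) = normSum q x := by
  obtain ⟨σ, hσ⟩ := exists_ringHom_eq_pow hF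
  obtain ⟨φ, hφ⟩ := exists_linearEquiv_diagonal hF hσ hH.2
  refine ⟨φ, fun x => ?_⟩
  rw [eval_hermitianForm hσ, hφ, normSum]
  exact Finset.sum_congr rfl fun i _ => by rw [hrank, if_pos i.2]

theorem exists_linearEquiv_normSum_tail (hF : Fintype.card F = q ^ 2)
    {H : Matrix (Fin (n + 1)) (Fin (n + 1)) F}
    (hH : IsHermitianMatrix q H) (hrank : H.rank = n) :
    ∃ φ : (Fin (n + 1) → F) ≃ₗ[F] (Fin (n + 1) → F), ∀ x,
      MvPolynomial.eval (φ x) (hermitianForm q H) = normSum q (Fin.tail x) := by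
  obtain ⟨σ, hσ⟩ := exists_ringHom_eq_pow hF
  obtain ⟨φ, hφ⟩ := exists_linearEquiv_diagonal hF hσ hH.2
  -- The diagonal form has its zero in the last place; reversing the coordinates moves the vertex
  -- direction to the first.
  refine ⟨(LinearEquiv.funCongrLeft F F Fin.revPerm).trans φ, fun x => ?_⟩
  rw [LinearEquiv.trans_apply, eval_hermitianForm hσ, hφ, normSum, ← Equiv.sum_comp Fin.revPerm,
    Fin.sum_univ_succ]
  simp only [hrank, Fin.revPerm_apply, LinearEquiv.funCongrLeft_apply, LinearMap.funLeft_apply,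
    Fin.rev_rev, Fin.rev_zero, Fin.val_last, lt_irrefl, if_false, zero_add, Fin.tail]
  refine Finset.sum_congr rfl fun i _ => if_pos ?_
  rw [Fin.val_rev, Fin.val_succ]
  omega

open Classical in
/-- The points common to a Hermitian variety and a hypersurface, counted by vectors in other
coordinates. -/
theorem card_inter_zeros_mul {N : ℕ} (H : Matrix (Fin N) (Fin N) F)
    (φ : (Fin N → F) ≃ₗ[F] (Fin N → F)) {f : (Fin N → F) → F}
    (hφ : ∀ x, MvPolynomial.eval (φ x) (hermitianForm q H) = f x) {d : ℕ}
    {G : MvPolynomial (Fin N) F} (hG : G.IsHomogeneous d) :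
    Nat.card ↥(hermitianVariety q H ∩ zeros G) * (Fintype.card F - 1) =
      (Finset.univ.filter fun x : Fin N → F =>
        x ≠ 0 ∧ f x = 0 ∧ MvPolynomial.eval (φ x) G = 0).card := by
  have h := card_points_mul (F := F) (N := N) (fun x =>
    MvPolynomial.eval x (hermitianForm q H) = 0 ∧ MvPolynomial.eval x G = 0) ?_
  · refine Eq.trans h (Finset.card_bij' (fun x _ => φ.symm x) (fun x _ => φ x) ?_ ?_ ?_ ?_)
    · intro x hx
      simp only [Finset.mem_filter, Finset.mem_univ, true_and] at hx ⊢
      refine ⟨by simpa using hx.1, ?_, by simpa using hx.2.2⟩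
      rw [← hφ]
      simpa using hx.2.1
    · intro x hx
      simp only [Finset.mem_filter, Finset.mem_univ, true_and] at hx ⊢
      refine ⟨by simpa using hx.1, ?_, hx.2.2⟩
      rw [hφ]
      exact hx.2.1
    · intro x _
      simp
    · intro x _
      simp
  · rintro c x - ⟨h1, h2⟩
    rw [eval_smul_of_isHomogeneous (isHomogeneous_hermitianForm q H), h1,
      eval_smul_of_isHomogeneous hG, h2]
    simp

open Classical in
theorem card_hermitianVariety_mul {N : ℕ} (H : Matrix (Fin N) (Fin N) F)
    (φ : (Fin N → F) ≃ₗ[F] (Fin N → F)) {f : (Fin N → F) → F}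
    (hφ : ∀ x, MvPolynomial.eval (φ x) (hermitianForm q H) = f x) :
    Nat.card (hermitianVariety q H) * (Fintype.card F - 1) =
      (Finset.univ.filter fun x : Fin N → F => x ≠ 0 ∧ f x = 0).card := by
  have h := card_inter_zeros_mul H φ hφ (MvPolynomial.isHomogeneous_zero (Fin N) F 0)
  have hz : zeros (0 : MvPolynomial (Fin N) F) = Set.univ := by simp [zeros]
  rw [hz, Set.inter_univ] at h
  simpa using h

theorem card_inter_zeros_le_maxSection {N d : ℕ} (X : Set (ℙ F (Fin N → F)))
    {G : MvPolynomial (Fin N) F} (hG : G.IsHomogeneous d) (hG0 : G ≠ 0) :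
    Nat.card ↥(X ∩ zeros G) ≤ maxSection X d := by
  -- The supremum is a true maximum only for a bounded set; `Nat.card X` is a bound.
  refine le_csSup ⟨Nat.card X, ?_⟩ ⟨G, hG0, hG, rfl⟩
  rintro k ⟨G', -, -, rfl⟩
  exact Nat.card_mono (Set.toFinite X) Set.inter_subset_left

/-- On the projective line, any `d` points are the zeros of a form of degree `d`. -/
theorem le_maxSection_of_two {d : ℕ} (X : Set (ℙ F (Fin 2 → F))) (hd : d ≤ Nat.card X) :
    d ≤ maxSection X d := by
  classical
  have : Fintype X := Fintype.ofFinite _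
  rw [Nat.card_eq_fintype_card, ← Set.toFinset_card] at hd
  obtain ⟨S, hSX, hS⟩ := Finset.exists_subset_card_eq hd
  let G : MvPolynomial (Fin 2) F := ∏ P ∈ S, (MvPolynomial.C (normRep P 1) * MvPolynomial.X 0 -
    MvPolynomial.C (normRep P 0) * MvPolynomial.X 1)
  have hG : G.IsHomogeneous d := by
    have := MvPolynomial.IsHomogeneous.prod S (fun P : ℙ F (Fin 2 → F) =>
      (MvPolynomial.C (normRep P 1) * MvPolynomial.X 0 -
        MvPolynomial.C (normRep P 0) * MvPolynomial.X 1 : MvPolynomial (Fin 2) F)) (fun _ => 1)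
      (fun P _ => (MvPolynomial.isHomogeneous_C_mul_X _ _).sub
        (MvPolynomial.isHomogeneous_C_mul_X _ _))
    simpa [hS] using this
  have hG0 : G ≠ 0 := by
    refine Finset.prod_ne_zero_iff.2 fun P _ h0 => normRep_ne_zero P ?_
    have h1 := congrArg (MvPolynomial.eval ![1, 0]) h0
    have h2 := congrArg (MvPolynomial.eval ![0, 1]) h0
    ext i
    fin_cases i
    · simpa using h2
    · simpa using h1
  refine le_trans ?_ (card_inter_zeros_le_maxSection X hG hG0)
  have hcard : d = Nat.card (S : Set (ℙ F (Fin 2 → F))) := by simp [hS]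
  rw [hcard]
  refine Nat.card_mono (Set.toFinite _) fun P hP => ⟨by simpa using hSX hP, ?_⟩
  change MvPolynomial.eval _ _ = 0
  rw [map_prod]
  refine Finset.prod_eq_zero hP ?_
  simp [mul_comm]

end Transfer

/-! ### Bounds for the zeros of a form on a Hermitian cone. -/

section Bound

variable {F : Type*} [Field F] [Fintype F] {q k : ℕ}

theorem card_cone_eq (hF : Fintype.card F = q ^ 2)
    {H : Matrix (Fin (k + 3)) (Fin (k + 3)) F} (hH : IsHermitianMatrix q H)
    (hrank : H.rank = k + 2) {H' : Matrix (Fin (k + 2)) (Fin (k + 2)) F}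
    (hH' : IsHermitianMatrix q H') (hrank' : H'.rank = k + 2) :
    Nat.card (hermitianVariety q H) = 1 + q ^ 2 * Nat.card (hermitianVariety q H') := by
  classical
  have hq := two_le_of_card_eq_sq hF
  obtain ⟨φ, hφ⟩ := exists_linearEquiv_normSum_tail hF hH hrank
  obtain ⟨φ', hφ'⟩ := exists_linearEquiv_normSum hF hH' hrank'
  have h1 := card_hermitianVariety_mul H φ hφ
  have h2 := card_hermitianVariety_mul H' φ' hφ'
  have h3 := card_cone_isotropic (n := k + 2) hF
  rw [← card_isotropic_ne_zero, ← h1, ← h2, hF] at h3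
  obtain ⟨r, hr⟩ : ∃ r, q ^ 2 = r + 2 := ⟨q ^ 2 - 2, by
    have : 2 ≤ q ^ 2 := by nlinarith
    omega⟩
  rw [hr] at h3 ⊢
  have e1 : r + 2 - 1 = r + 1 := by omega
  rw [e1] at h3
  refine Nat.eq_of_mul_eq_mul_right (Nat.succ_pos r) ?_
  rw [Nat.succ_eq_add_one]
  linarith

theorem card_nondegenerate_mul (hF : Fintype.card F = q ^ 2)
    {H' : Matrix (Fin (k + 2)) (Fin (k + 2)) F}
    (hH' : IsHermitianMatrix q H') (hrank' : H'.rank = k + 2) :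
    (Nat.card (hermitianVariety q H') : ℤ) * (q ^ 2 - 1) =
      (q ^ (k + 1) - (-1) ^ (k + 1)) * (q ^ (k + 2) - (-1) ^ (k + 2)) := by
  classical
  have hq := two_le_of_card_eq_sq hF
  obtain ⟨φ', hφ'⟩ := exists_linearEquiv_normSum hF hH' hrank'
  have h2 := card_hermitianVariety_mul H' φ' hφ'
  rw [← card_isotropic_eq hF, ← h2, hF, Nat.cast_mul, Nat.cast_sub (Nat.one_le_pow _ _ (by omega))]
  simp

/-- With `r = q ^ k`, the right side minus the left, times `q ^ 2 - 1`, is `r ^ 2 (q ^ 2 - q - 1) ∓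
r (q ^ 2 - q) + 1`, with the minus sign for even `k`. It vanishes at `k = 0`. -/
theorem card_nondegenerate_le (hF : Fintype.card F = q ^ 2)
    {H' : Matrix (Fin (k + 2)) (Fin (k + 2)) F}
    (hH' : IsHermitianMatrix q H') (hrank' : H'.rank = k + 2) :
    (Nat.card (hermitianVariety q H') : ℤ) ≤ (q + 1) * q ^ (2 * k) := by
  have hq : (2 : ℤ) ≤ q := by exact_mod_cast two_le_of_card_eq_sq hF
  have h := card_nondegenerate_mul hF hH' hrank'
  refine le_of_mul_le_mul_right ?_ (by nlinarith : (0 : ℤ) < q ^ 2 - 1)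
  rw [h, mul_comm 2 k, pow_mul]
  rcases Nat.even_or_odd k with hk | hk
  · have e1 : (-1 : ℤ) ^ k = 1 := hk.neg_one_pow
    simp only [pow_succ, e1]
    rcases Nat.eq_zero_or_pos k with rfl | hk0
    · simp
    · have hr : (2 : ℤ) ≤ q ^ k := hq.trans (le_self_pow₀ (by linarith) hk0.ne')
      set r : ℤ := (q : ℤ) ^ k
      have hA : (2 : ℤ) ≤ q ^ 2 - q := by nlinarith
      have hB : r * (q ^ 2 - q) ≤ r * (r * (q ^ 2 - q - 1)) := by
        refine mul_le_mul_of_nonneg_left ?_ (by linarith)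
        nlinarith
      nlinarith
  · have e1 : (-1 : ℤ) ^ k = -1 := hk.neg_one_pow
    simp only [pow_succ, e1]
    have hr : (1 : ℤ) ≤ q ^ k := one_le_pow₀ (by linarith)
    set r : ℤ := (q : ℤ) ^ k
    have hA : (1 : ℤ) ≤ q ^ 2 - q - 1 := by nlinarith
    have hB : 0 ≤ r ^ 2 * (q ^ 2 - q - 1) := by positivity
    nlinarith

/-- The case distinction behind the bound for the sections of a Hermitian cone. -/
theorem cone_bound_arith {q k d j e c u X M : ℕ} (hq : 2 ≤ q) (hd : d ≤ q) (hje : j + e = d)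
    (hcount : c + j * X ≤ (if e = 0 then 0 else 1) + q ^ 2 * X + j * u)
    (hule : (u : ℤ) ≤ (q + 1) * q ^ (2 * k)) (hXM : j = 0 → X ≤ M) (hX₀ : k = 0 → X ≤ e)
    (hX₁ : 1 ≤ k → X * (q ^ 2 - 1) ≤ e * (q + 1) * ((q ^ 2) ^ k - 1))
    (hM : k = 0 → u = q + 1 ∧ d ≤ M) :
    (c : ℤ) ≤ max ((u : ℤ) + ((d : ℤ) - 1) * (q + 1) * q ^ (2 * k)) (1 + q ^ 2 * (M : ℤ)) := by
  have hqz : (2 : ℤ) ≤ q := by exact_mod_cast hq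
  have hcz : (c : ℤ) + j * X ≤ (if e = 0 then 0 else 1) + q ^ 2 * X + j * u := by
    exact_mod_cast hcount
  have hdz : (d : ℤ) = j + e := by exact_mod_cast hje.symm
  rcases Nat.eq_zero_or_pos j with hj | hj
  · refine le_max_of_le_right ?_
    have hXMz : (X : ℤ) ≤ M := by exact_mod_cast hXM hj
    have hmul : (q : ℤ) ^ 2 * X ≤ q ^ 2 * M := mul_le_mul_of_nonneg_left hXMz (by positivity)
    rw [hj] at hcz
    split_ifs at hcz <;> push_cast at hcz <;> linarith
  have hjz : (1 : ℤ) ≤ j := by exact_mod_cast hj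
  have hXnn : (0 : ℤ) ≤ X := by positivity
  -- One copy of `u` is kept exact; the other `j - 1` are replaced by the upper bound.
  have hju : 0 ≤ ((j : ℤ) - 1) * ((q + 1) * q ^ (2 * k) - u) :=
    mul_nonneg (by linarith) (by linarith)
  rcases Nat.eq_zero_or_pos e with he | he
  · refine le_max_of_le_left ?_
    have hX0 : X = 0 := by
      rcases Nat.eq_zero_or_pos k with hk | hk
      · have := hX₀ hk
        omega
      · have := hX₁ hk
        rw [he, zero_mul, zero_mul, Nat.le_zero, Nat.mul_eq_zero] at this
        have h4 : 2 ^ 2 ≤ q ^ 2 := Nat.pow_le_pow_left hq 2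
        omega
    rw [hX0, if_pos he] at hcz
    rw [hdz, he]
    push_cast at hcz ⊢
    linarith
  have hez : (1 : ℤ) ≤ e := by exact_mod_cast he
  rw [if_neg he.ne'] at hcz
  rcases Nat.eq_zero_or_pos k with hk | hk
  -- On a line the comparison is with `1 + q ^ 2 M`, where `M ≥ d = j + e`; the slack is `j (q ^ 2 -
  -- (q + 1) + e)`.
  · refine le_max_of_le_right ?_
    have hXe : (X : ℤ) ≤ e := by exact_mod_cast hX₀ hk
    have huq : (u : ℤ) = q + 1 := by exact_mod_cast (hM hk).1
    have hMd : (d : ℤ) ≤ M := by exact_mod_cast (hM hk).2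
    have hjq : (j : ℤ) ≤ q := by exact_mod_cast (by omega : j ≤ q)
    have h1 : 0 ≤ ((q : ℤ) ^ 2 - j) * (e - X) := mul_nonneg (by nlinarith) (by linarith)
    have h2 : (q : ℤ) ^ 2 * d ≤ q ^ 2 * M := mul_le_mul_of_nonneg_left hMd (by positivity)
    have h3 : 0 ≤ (j : ℤ) * (q ^ 2 - (q + 1) + e) := mul_nonneg (by linarith) (by nlinarith)
    rw [huq] at hcz
    rw [hdz] at h2
    linarith
  -- The `-1` in `q ^ (2k) - 1` leaves a surplus `e (q + 1) ≥ 1`, which pays for the vertex.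
  · refine le_max_of_le_left ?_
    have h1 := hX₁ hk
    have h1z : (X : ℤ) * (q ^ 2 - 1) ≤ e * (q + 1) * (q ^ (2 * k) - 1) := by
      rw [← pow_mul] at h1
      have h := (Nat.cast_le (α := ℤ)).2 h1
      push_cast [Nat.one_le_pow 2 q (by omega), Nat.one_le_pow (2 * k) q (by omega)] at h
      exact h
    have h2 : 0 ≤ ((j : ℤ) - 1) * X := mul_nonneg (by linarith) hXnn
    have h3 : (1 : ℤ) ≤ e * (q + 1) := by nlinarith
    rw [hdz]
    linarith

/-- The number of zeros of a form of degree `d ≤ q` on a Hermitian cone. -/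
theorem card_cone_inter_zeros_le (hF : Fintype.card F = q ^ 2) {d : ℕ} (hd : d ≤ q)
    {H : Matrix (Fin (k + 3)) (Fin (k + 3)) F} (hH : IsHermitianMatrix q H)
    (hrank : H.rank = k + 2) {H' : Matrix (Fin (k + 2)) (Fin (k + 2)) F}
    (hH' : IsHermitianMatrix q H') (hrank' : H'.rank = k + 2)
    {G : MvPolynomial (Fin (k + 3)) F} (hG : G.IsHomogeneous d) (hG0 : G ≠ 0) :
    (Nat.card ↥(hermitianVariety q H ∩ zeros G) : ℤ) ≤
      max ((Nat.card (hermitianVariety q H') : ℤ) + ((d : ℤ) - 1) * (q + 1) * q ^ (2 * k))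
        (1 + q ^ 2 * (maxSection (hermitianVariety q H') d : ℤ)) := by
  classical
  have hq := two_le_of_card_eq_sq hF
  have hdF : d ≤ Fintype.card F := by rw [hF]; nlinarith
  obtain ⟨φ, hφ⟩ := exists_linearEquiv_normSum_tail hF hH hrank
  obtain ⟨φ', hφ'⟩ := exists_linearEquiv_normSum hF hH' hrank'
  obtain ⟨j, e, g, hje, hg, hg0, -, hcount⟩ := card_cone_section_le hF
    (isHomogeneous_linearSubst φ.toLinearMap hG) (linearSubst_ne_zero φ hG hdF hG0)
  have hT := card_inter_zeros_mul H φ hφ hG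
  have hg' := isHomogeneous_linearSubst φ'.symm.toLinearMap hg
  have hg0' := linearSubst_ne_zero φ'.symm hg (by omega) hg0
  have hX := card_inter_zeros_mul H' φ' hφ' hg'
  have hu := card_hermitianVariety_mul H' φ' hφ'
  have hXM := card_inter_zeros_le_maxSection (hermitianVariety q H') hg' hg0'
  simp only [eval_linearSubst, LinearEquiv.coe_coe, LinearEquiv.symm_apply_apply] at hX hcount
  rw [← hT, ← hX, ← hu, hF] at hcount
  have hule := card_nondegenerate_le hF hH' hrank'
  have hXle : (k = 0 → Nat.card ↥(hermitianVariety q H' ∩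
        zeros (linearSubst φ'.symm.toLinearMap g)) ≤ e) ∧
      (1 ≤ k → Nat.card ↥(hermitianVariety q H' ∩
        zeros (linearSubst φ'.symm.toLinearMap g)) * (q ^ 2 - 1) ≤
          e * (q + 1) * ((q ^ 2) ^ k - 1)) := by
    constructor
    · rintro rfl
      have := card_section_le_of_two hF (by omega) hg hg0
      rw [← hX, hF] at this
      refine Nat.le_of_mul_le_mul_right this ?_
      have : 2 ^ 2 ≤ q ^ 2 := Nat.pow_le_pow_left hq 2
      omega
    · intro hk
      have := card_section_le hF (by omega) (by omega) hg hg0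
      rwa [← hX, hF] at this
  set c := Nat.card ↥(hermitianVariety q H ∩ zeros G)
  set u := Nat.card (hermitianVariety q H') with hudef
  set X := Nat.card ↥(hermitianVariety q H' ∩ zeros (linearSubst φ'.symm.toLinearMap g))
  set M := maxSection (hermitianVariety q H') d with hM
  have hcount' : c + j * X ≤ (if e = 0 then 0 else 1) + q ^ 2 * X + j * u := by
    have h4 : 2 ^ 2 ≤ q ^ 2 := Nat.pow_le_pow_left hq 2
    refine Nat.le_of_mul_le_mul_right (c := q ^ 2 - 1) ?_ (by omega)
    refine le_trans (le_of_eq ?_) (hcount.trans (le_of_eq ?_))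
    · ring
    · split_ifs <;> ring
  refine cone_bound_arith hq hd hje hcount' hule (fun hj => ?_) hXle.1 hXle.2 (fun hk => ?_)
  · have hed : e = d := by omega
    rwa [hed] at hXM
  · subst hk
    have huq : (u : ℤ) = q + 1 := by
      have h := card_nondegenerate_mul hF hH' hrank'
      have hqz : (2 : ℤ) ≤ q := by exact_mod_cast hq
      refine mul_right_cancel₀ (b := (q : ℤ) ^ 2 - 1) (by nlinarith) (h.trans ?_)
      ring
    have huq' : u = q + 1 := by exact_mod_cast huq
    exact ⟨huq', le_maxSection_of_two _ (by omega)⟩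

/-- No nonzero form of degree `d ≤ q` vanishes on a Hermitian cone. -/
theorem card_cone_inter_zeros_lt (hF : Fintype.card F = q ^ 2) {d : ℕ} (hd : d ≤ q)
    {H : Matrix (Fin (k + 3)) (Fin (k + 3)) F} (hH : IsHermitianMatrix q H)
    (hrank : H.rank = k + 2)
    {G : MvPolynomial (Fin (k + 3)) F} (hG : G.IsHomogeneous d) (hG0 : G ≠ 0) :
    Nat.card ↥(hermitianVariety q H ∩ zeros G) < Nat.card (hermitianVariety q H) := by
  classical
  have hq := two_le_of_card_eq_sq hF
  have hdF : d ≤ Fintype.card F := by rw [hF]; nlinarith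
  obtain ⟨φ, hφ⟩ := exists_linearEquiv_normSum_tail hF hH hrank
  obtain ⟨j, e, g, hje, hg, hg0, hroots, -⟩ := card_cone_section_le hF
    (isHomogeneous_linearSubst φ.toLinearMap hG) (linearSubst_ne_zero φ hG hdF hG0)
  obtain ⟨x, hx0, hxn, hxg⟩ := exists_isotropic_eval_ne_zero hF (by omega) (by omega) hg hg0
  -- Above `x` there are at most `j ≤ q < q ^ 2` roots.
  obtain ⟨t, ht⟩ : ∃ t : F, MvPolynomial.eval (φ (Fin.cons t x : Fin (k + 3) → F)) G ≠ 0 := by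
    by_contra! hall
    have h := hroots x hxg
    simp only [eval_linearSubst, LinearEquiv.coe_coe] at h
    rw [Finset.filter_true_of_mem fun t _ => hall t, Finset.card_univ, hF] at h
    nlinarith
  refine lt_of_mul_lt_mul_right (a := Fintype.card F - 1) ?_ (Nat.zero_le _)
  rw [card_inter_zeros_mul H φ hφ hG, card_hermitianVariety_mul H φ hφ]
  refine Finset.card_lt_card (Finset.ssubset_iff_of_subset ?_ |>.2 ?_)
  · exact Finset.monotone_filter_right _ fun z _ hz => ⟨hz.1, hz.2.1⟩
  · refine ⟨Fin.cons t x, ?_, fun h => ht (Finset.mem_filter.1 h).2.2.2⟩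
    refine Finset.mem_filter.2 ⟨Finset.mem_univ _, fun h0 => hx0 ?_, by simpa using hxn⟩
    have := congrArg Fin.tail h0
    rw [Fin.tail_cons] at this
    exact this

end Bound

/-! ### Codeword weights. -/

section Code

variable {F : Type*} [Field F]

/-- The weight of the codeword of `G` and the number of zeros of `G` add up to the length. -/
theorem hammingNorm_evalMap_add [DecidableEq F] {N m d : ℕ} (X : Set (ℙ F (Fin N → F)))
    (e : Fin m ≃ X) (G : MvPolynomial.homogeneousSubmodule (Fin N) F d) :
    hammingNorm (evalMap d (fun i => (e i : ℙ F (Fin N → F))) G) +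
      Nat.card ↥(X ∩ zeros (G : MvPolynomial (Fin N) F)) = m := by
  have h : Nat.card ↥(X ∩ zeros (G : MvPolynomial (Fin N) F)) =
      (Finset.univ.filter fun i : Fin m =>
        ¬ evalMap d (fun i => (e i : ℙ F (Fin N → F))) G i ≠ 0).card := by
    rw [← Fintype.card_subtype, ← Nat.card_eq_fintype_card]
    refine Nat.card_congr ⟨fun P => ⟨e.symm ⟨P.1, P.2.1⟩, ?_⟩, fun i => ⟨(e i.1).1, (e i.1).2, ?_⟩,
      fun P => ?_, fun i => ?_⟩
    · rw [not_not]
      change MvPolynomial.eval (normRep (e (e.symm ⟨P.1, P.2.1⟩) : ℙ F (Fin N → F))) _ = 0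
      rw [Equiv.apply_symm_apply]
      exact P.2.2
    · exact not_not.1 i.2
    · simp
    · simp
  rw [h, hammingNorm, Finset.card_filter_add_card_filter_not, Finset.card_univ, Fintype.card_fin]

end Code

end HermitianCode

open HermitianCode in
theorem mainTheorem3 {F : Type*} [Field F] [Fintype F] (q n d m : ℕ)
    (hF : Fintype.card F = q ^ 2) (hn : 2 ≤ n) (hd : d ≤ q)
    -- a Hermitian variety of rank `n` in `ℙ^n`, with an enumeration of its rational points
    (H : Matrix (Fin (n + 1)) (Fin (n + 1)) F) (hH : IsHermitianMatrix q H) (hrank : H.rank = n)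
    (e : Fin m ≃ hermitianVariety q H)
    -- a non-degenerate Hermitian variety in `ℙ^(n-1)`
    (H' : Matrix (Fin n) (Fin n) F) (hH' : IsHermitianMatrix q H') (hrank' : H'.rank = n) :
    m = Nat.card (hermitianVariety q H) ∧
    (m : ℚ) = 1 + (q : ℚ) ^ 2 *
      (((q : ℚ) ^ (n - 1) - (-1) ^ (n - 1)) * ((q : ℚ) ^ n - (-1) ^ n) / ((q : ℚ) ^ 2 - 1)) ∧
    Module.finrank F (functionalCode d (hermitianVariety q H) e) = (n + d).choose d ∧
    (Nat.card (hermitianVariety q H) : ℤ) -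
        max ((Nat.card (hermitianVariety q H') : ℤ) + ((d : ℤ) - 1) * (q + 1) * q ^ (2 * n - 4))
          (1 + q ^ 2 * (maxSection (hermitianVariety q H') d : ℤ))
      ≤ (minDist (functionalCode d (hermitianVariety q H) e) : ℤ) := by
  classical
  obtain ⟨k, rfl⟩ : ∃ k, n = k + 2 := ⟨n - 2, by omega⟩
  have hq := two_le_of_card_eq_sq hF
  have hm : m = Nat.card (hermitianVariety q H) := by
    rw [← Nat.card_congr e, Nat.card_eq_fintype_card, Fintype.card_fin]
  have hinj : Function.Injective
      (evalMap d fun i => (e i : Projectivization F (Fin (k + 2 + 1) → F))) := by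
    rw [injective_iff_map_eq_zero]
    intro G hG
    by_contra hG0
    have h1 := hammingNorm_evalMap_add (hermitianVariety q H) e G
    have h2 := card_cone_inter_zeros_lt hF hd hH hrank G.2 fun h0 => hG0 (Subtype.ext h0)
    rw [hG, hammingNorm_zero] at h1
    omega
  have hfin : Module.finrank F (functionalCode d (hermitianVariety q H) e) =
      (k + 2 + d).choose d := by
    rw [functionalCode, LinearMap.finrank_range_of_inj hinj, finrank_homogeneousSubmodule]
  refine ⟨hm, ?_, hfin, ?_⟩
  · have h1 := card_cone_eq hF hH hrank hH' hrank'
    have h2 := card_nondegenerate_mul hF hH' hrank'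
    have h2q : (Nat.card (hermitianVariety q H') : ℚ) * ((q : ℚ) ^ 2 - 1) =
      ((q : ℚ) ^ (k + 1) - (-1) ^ (k + 1)) * ((q : ℚ) ^ (k + 2) - (-1) ^ (k + 2)) := by
      exact_mod_cast h2
    have hq2 : (q : ℚ) ^ 2 - 1 ≠ 0 := by
      have : (2 : ℚ) ≤ q := by exact_mod_cast hq
      nlinarith
    rw [hm, h1]
    push_cast
    rw [← h2q, mul_div_cancel_right₀ _ hq2]
  -- Over the empty set the infimum would be `0`; the positive dimension supplies a nonzero
  -- codeword, so the minimum is attained.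
  · have hne : {w | ∃ c ∈ functionalCode d (hermitianVariety q H) e,
        c ≠ 0 ∧ w = hammingNorm c}.Nonempty := by
      have hbot : functionalCode d (hermitianVariety q H) e ≠ ⊥ := by
        intro h0
        rw [h0, finrank_bot] at hfin
        exact (Nat.choose_pos (by omega : d ≤ k + 2 + d)).ne hfin
      obtain ⟨c, hc, hc0⟩ := Submodule.exists_mem_ne_zero_of_ne_bot hbot
      exact ⟨_, c, hc, hc0, rfl⟩
    obtain ⟨c, ⟨G, rfl⟩, hc0, hw⟩ := Nat.sInf_mem hne
    have hG0 : (G : MvPolynomial (Fin (k + 2 + 1)) F) ≠ 0 := by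
      intro h0
      exact hc0 (by rw [Subtype.ext (a1 := G) (a2 := 0) h0, map_zero])
    have h1 := hammingNorm_evalMap_add (hermitianVariety q H) e G
    have h2 := card_cone_inter_zeros_le hF hd hH hrank hH' hrank' G.2 hG0
    have hmin : minDist (functionalCode d (hermitianVariety q H) e) = hammingNorm
        (evalMap d (fun i => (e i : Projectivization F (Fin (k + 2 + 1) → F))) G) := by
      rw [minDist]
      convert hw
    have e1 : 2 * (k + 2) - 4 = 2 * k := by omega
    rw [hmin, e1]
    have h3 : (hammingNorm (evalMap d
        (fun i => (e i : Projectivization F (Fin (k + 2 + 1) → F))) G) : ℤ) +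
        Nat.card ↥(hermitianVariety q H ∩ zeros (G : MvPolynomial (Fin (k + 2 + 1)) F)) =
        Nat.card (hermitianVariety q H) := by
      rw [← hm]
      exact_mod_cast h1
    linarith
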